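/- Let $M$ be a supermanifold of dimension $n|m$ with $n-m\neq -1$ and $n-m\neq -3$. Write $\tilde\imath\in\mathbb Z/2$ for the parity of the coordinate $x^i$ and $\partial_i$ for left partial derivatives, and sum over repeated indices. Two symmetric (torsion-free) linear connections on $M$, with coefficients $\nabla_{\partial_j}\partial_i=\Gamma^k_{ji}\partial_k$, define the same projective class if in all coordinate systems they have the same $$\Pi^k_{ji}=\Gamma^k_{ji}-\frac1{n-m+1}\left(\Gamma^s_{js}\,\delta^k_i(-1)^{\tilde s}+\Gamma^s_{is}\,\delta^k_j(-1)^{\tilde\imath\tilde\jmath+\tilde s}\right).$$ Let $M$ be equipped with a projective class, with coefficients $\Pi^k_{ji}$, and with a supersymmetric contravariant tensor field $S$ of rank two and of parity $\tilde S$, with components $S^{ij}=S(dx^i,dx^j)=(-1)^{\tilde\imath\tilde\jmath}S^{ji}$ of parity $\tilde S+\tilde\imath+\tilde\jmath$. 1. The expression $$S^{ij}\partial_j\partial_i+\left(\frac{2}{n-m+3}\,\partial_jS^{ji}(-1)^{\tilde\jmath(\tilde S+1)}-\frac{n-m+1}{n-m+3}\,S^{jk}\Pi^i_{kj}\right)\partial_i$$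 does not depend on the coordinate system: on the overlap of any two coordinate systems the two expressions define the same operator on functions, and there is a unique operator on the sheaf of functions of $M$ which is given by this expression in every coordinate system (the super projective Laplacian). 2. There is a unique upper connection $\nabla$ over $S$ in the bundle of volume forms (the Berezinian bundle, whose local generators transform by $D\bar x=\mathrm{Ber}(\partial\bar x/\partial x)\,Dx$) whose coefficients in every coordinate system, $\nabla^{dx^i}Dx=\gamma^i\,Dx$, are $$\gamma^i=\frac{n-m+1}{n-m+3}\left(\partial_jS^{ji}(-1)^{\tilde\jmath(\tilde S+1)}+S^{jk}\Pi^i_{kj}\right).$$ Here an upper connection over $S$ is a biadditive map $(\omega,\sigma)\mapsto\nabla^\omega\sigma$ of parity $\tilde S$ from one-forms and volume forms to volume forms, compatible with restriction to open subsets, such that for homogeneous $f$ and $\omega$ $$\nabla^{f\omega}\sigma=(-1)^{\tilde S\tilde f}f\,\nabla^{\omega}\sigma,\qquad \nabla^{\omega}(f\sigma)=S(\omega,df)\,\sigma+(-1)^{\tilde f(\tilde S+\tilde\omega)}f\,\nabla^\omega\sigma.$$ -/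

import Mathlib

open scoped TensorProduct
open TopologicalSpace

namespace Supergeometry

universe u v

noncomputable section

/-- The sign `(-1)^p` of a parity `p`. -/
def sgn (p : ZMod 2) : ℝ := if p = 0 then 1 else -1

/-- The index set of the coordinates on an `n|m`-dimensional superspace: `n` even and `m` odd ones. -/
abbrev Idx (n m : ℕ) : Type := Fin n ⊕ Fin m

/-- The parity `ĩ` of a coordinate index. -/
def par {n m : ℕ} : Idx n m → ZMod 2
  | Sum.inl _ => 0
  | Sum.inr _ => 1

/-- `D` is a superderivation of parity `p` of the algebra `A` with the `ℤ/2`-grading `gr`. -/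
def IsSuperDer {A : Type*} [Ring A] [Algebra ℝ A] (gr : ZMod 2 → Submodule ℝ A) (p : ZMod 2)
    (D : A →ₗ[ℝ] A) : Prop :=
  (∀ q, ∀ f ∈ gr q, D f ∈ gr (p + q)) ∧
    ∀ q, ∀ f ∈ gr q, ∀ g, D (f * g) = D f * g + sgn (p * q) • (f * D g)

/-! ### The model superdomains: `C^∞(V) ⊗ Λ(ℝ^m)` for open `V ⊆ ℝ^n` -/

section Model

open scoped ContDiff

variable {n : ℕ}

/-- The extension by zero of a function on `V`. -/
def extZero (V : Opens (Fin n → ℝ)) (f : V → ℝ) : (Fin n → ℝ) → ℝ :=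
  Function.extend Subtype.val f 0

theorem extZero_apply (V : Opens (Fin n → ℝ)) (f : V → ℝ) (x : V) : extZero V f x = f x :=
  Subtype.val_injective.extend_apply f 0 x

theorem extZero_congr {V : Opens (Fin n → ℝ)} {f : V → ℝ} {g : (Fin n → ℝ) → ℝ}
    (h : ∀ x : V, f x = g x) : Set.EqOn (extZero V f) g V := fun x hx => by
  rw [← h ⟨x, hx⟩]; exact extZero_apply V f ⟨x, hx⟩

/-- The algebra `C^∞(V)`. -/
def smoothFun (V : Opens (Fin n → ℝ)) : Subalgebra ℝ (V → ℝ) where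
  carrier := {f | ContDiffOn ℝ ∞ (extZero V f) V}
  mul_mem' {f g} hf hg := (ContDiffOn.mul hf hg).congr
    (extZero_congr fun x => by simp [extZero_apply])
  add_mem' {f g} hf hg := (ContDiffOn.add hf hg).congr
    (extZero_congr fun x => by simp [extZero_apply])
  algebraMap_mem' r := (contDiffOn_const (c := r)).congr (extZero_congr fun _ => rfl)

/-- Restriction `C^∞(V) → C^∞(V')`. -/
def smoothRes {V V' : Opens (Fin n → ℝ)} (h : V' ≤ V) : smoothFun V →ₐ[ℝ] smoothFun V' where
  toFun f := ⟨fun x => f.1 ⟨x.1, h x.2⟩, (ContDiffOn.mono f.2 h).congr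
    (extZero_congr fun x => (extZero_apply V f.1 ⟨x.1, h x.2⟩).symm)⟩
  map_one' := rfl
  map_mul' _ _ := rfl
  map_zero' := rfl
  map_add' _ _ := rfl
  commutes' _ := rfl

/-- The coordinate function `x^i` on `V`. -/
def smoothCoord (V : Opens (Fin n → ℝ)) (i : Fin n) : smoothFun V :=
  ⟨fun x => x.1 i, (contDiff_apply ℝ ℝ i).contDiffOn.congr (extZero_congr fun _ => rfl)⟩

theorem smoothFun_differentiableAt {V : Opens (Fin n → ℝ)} (f : smoothFun V) (x : V) :
    DifferentiableAt ℝ (extZero V f.1) x.1 :=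
  (ContDiffOn.contDiffAt f.2 (V.2.mem_nhds x.2)).differentiableAt (by simp)

theorem fderiv_extZero {V : Opens (Fin n → ℝ)} {f : V → ℝ} {g : (Fin n → ℝ) → ℝ}
    (h : ∀ x : V, f x = g x) (x : V) : fderiv ℝ (extZero V f) x.1 = fderiv ℝ g x.1 :=
  Filter.EventuallyEq.fderiv_eq
    (Filter.eventuallyEq_of_mem (V.2.mem_nhds x.2) (extZero_congr h))

/-- The partial derivative `∂/∂x^i` on `C^∞(V)`. -/
def smoothPd (V : Opens (Fin n → ℝ)) (i : Fin n) : Derivation ℝ (smoothFun V) (smoothFun V) :=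
  Derivation.mk'
    { toFun := fun f => ⟨fun x => fderiv ℝ (extZero V f.1) x.1 (Pi.single i 1), by
        have h : ContDiffOn ℝ ∞ (fderiv ℝ (extZero V f.1)) V :=
          ContDiffOn.fderiv_of_isOpen f.2 V.2 (by simp)
        exact (h.clm_apply contDiffOn_const).congr (extZero_congr fun _ => rfl)⟩
      map_add' := fun f g => by
        ext x
        change fderiv ℝ (extZero V (f.1 + g.1)) x.1 _ = fderiv ℝ _ x.1 _ + fderiv ℝ _ x.1 _
        rw [fderiv_extZero (g := extZero V f.1 + extZero V g.1)
          (fun x => by simp [extZero_apply]),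
          fderiv_add (smoothFun_differentiableAt f x) (smoothFun_differentiableAt g x)]
        rfl
      map_smul' := fun r f => by
        ext x
        change fderiv ℝ (extZero V (r • f.1)) x.1 _ = r * fderiv ℝ _ x.1 _
        rw [fderiv_extZero (g := r • extZero V f.1) (fun x => by simp [extZero_apply]),
          fderiv_const_smul (smoothFun_differentiableAt f x)]
        rfl }
    fun f g => by
      ext x
      change fderiv ℝ (extZero V (f.1 * g.1)) x.1 _ =
        f.1 x * fderiv ℝ _ x.1 _ + g.1 x * fderiv ℝ _ x.1 _
      rw [fderiv_extZero (g := extZero V f.1 * extZero V g.1)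
        (fun x => by simp [extZero_apply]),
        fderiv_mul (smoothFun_differentiableAt f x) (smoothFun_differentiableAt g x),
        extZero_apply, extZero_apply]
      rfl

/-- The algebra of superfunctions on the superdomain over `V` with `m` odd coordinates. -/
abbrev Model (m : ℕ) (V : Opens (Fin n → ℝ)) : Type :=
  smoothFun V ⊗[ℝ] ExteriorAlgebra ℝ (Fin m → ℝ)

variable {m : ℕ}

/-- The even (`q = 0`) and odd (`q = 1`) superfunctions. -/
def modelGr (m : ℕ) (V : Opens (Fin n → ℝ)) (q : ZMod 2) : Submodule ℝ (Model m V) :=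
  LinearMap.range (LinearMap.lTensor (smoothFun V)
    (CliffordAlgebra.evenOdd (0 : QuadraticForm ℝ (Fin m → ℝ)) q).subtype)

/-- Restriction of superfunctions. -/
def modelRes (m : ℕ) {V V' : Opens (Fin n → ℝ)} (h : V' ≤ V) : Model m V →ₐ[ℝ] Model m V' :=
  Algebra.TensorProduct.map (smoothRes h) (AlgHom.id ℝ _)

/-- The even coordinates `x^i` and the odd coordinates `ξ^j`. -/
def modelCoord (V : Opens (Fin n → ℝ)) : Idx n m → Model m V
  | Sum.inl i => smoothCoord V i ⊗ₜ 1
  | Sum.inr j => 1 ⊗ₜ ExteriorAlgebra.ι ℝ (Pi.single j 1)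

/-- The (left) partial derivatives `∂/∂x^i` and `∂/∂ξ^j`; the latter is the contraction with the
`j`-th coordinate functional, that is, the left antiderivation of `Λ(ℝ^m)` with
`ξ^k ↦ δ^k_j`. -/
def modelPd (V : Opens (Fin n → ℝ)) : Idx n m → (Model m V →ₗ[ℝ] Model m V)
  | Sum.inl i => LinearMap.rTensor _ (smoothPd V i : smoothFun V →ₗ[ℝ] smoothFun V)
  | Sum.inr j => LinearMap.lTensor _ (CliffordAlgebra.contractLeft
      (Q := (0 : QuadraticForm ℝ (Fin m → ℝ))) (LinearMap.proj j))

theorem modelGr_induction {V : Opens (Fin n → ℝ)} {q : ZMod 2} {P : Model m V → Prop}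
    (h0 : P 0) (hadd : ∀ x y, P x → P y → P (x + y))
    (ht : ∀ a, ∀ w ∈ CliffordAlgebra.evenOdd (0 : QuadraticForm ℝ (Fin m → ℝ)) q,
      P (a ⊗ₜ (w : ExteriorAlgebra ℝ (Fin m → ℝ)))) :
    ∀ f ∈ modelGr m V q, P f := by
  rintro _ ⟨t, rfl⟩
  induction t using TensorProduct.induction_on with
  | zero => simpa using h0
  | tmul a w => exact ht a w.1 w.2
  | add x y hx hy => rw [map_add]; exact hadd _ _ hx hy

theorem tmul_mem_modelGr {V : Opens (Fin n → ℝ)} {q : ZMod 2} (a : smoothFun V)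
    {w : ExteriorAlgebra ℝ (Fin m → ℝ)}
    (hw : w ∈ CliffordAlgebra.evenOdd (0 : QuadraticForm ℝ (Fin m → ℝ)) q) :
    a ⊗ₜ w ∈ modelGr m V q := ⟨a ⊗ₜ ⟨w, hw⟩, rfl⟩

theorem involute_contractLeft {E : Type*} [AddCommGroup E] [Module ℝ E] {Q : QuadraticForm ℝ E}
    (d : Module.Dual ℝ E) (x : CliffordAlgebra Q) :
    CliffordAlgebra.involute (CliffordAlgebra.contractLeft d x) =
      -CliffordAlgebra.contractLeft d (CliffordAlgebra.involute x) := by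
  induction x using CliffordAlgebra.left_induction with
  | algebraMap r => simp [CliffordAlgebra.contractLeft_algebraMap]
  | add x y hx hy => simp only [map_add, hx, hy]; abel
  | ι_mul x a hx =>
    simp only [CliffordAlgebra.contractLeft_ι_mul, map_sub, map_smul, map_mul,
      CliffordAlgebra.involute_ι, hx, neg_mul, map_neg]
    simp only [mul_neg, neg_neg, neg_sub]

theorem contractLeft_mul {E : Type*} [AddCommGroup E] [Module ℝ E] {Q : QuadraticForm ℝ E}
    (d : Module.Dual ℝ E) (x y : CliffordAlgebra Q) :
    CliffordAlgebra.contractLeft d (x * y) = CliffordAlgebra.contractLeft d x * y +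
      CliffordAlgebra.involute x * CliffordAlgebra.contractLeft d y := by
  induction x using CliffordAlgebra.left_induction with
  | algebraMap r =>
    simp [CliffordAlgebra.contractLeft_algebraMap, CliffordAlgebra.contractLeft_algebraMap_mul]
  | add x x' hx hx' => simp only [map_add, add_mul, hx, hx']; abel
  | ι_mul x a hx =>
    simp only [mul_assoc, CliffordAlgebra.contractLeft_ι_mul, map_mul,
      CliffordAlgebra.involute_ι, hx, sub_mul, mul_add, smul_mul_assoc, neg_mul]
    abel

theorem zmod2_cases (q : ZMod 2) : q = 0 ∨ q = 1 := by
  revert q; decide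

theorem involute_of_mem {E : Type*} [AddCommGroup E] [Module ℝ E] {Q : QuadraticForm ℝ E}
    {q : ZMod 2} {x : CliffordAlgebra Q} (hx : x ∈ CliffordAlgebra.evenOdd Q q) :
    CliffordAlgebra.involute x = sgn q • x := by
  rcases zmod2_cases q with rfl | rfl
  · simp [sgn, CliffordAlgebra.involute_eq_of_mem_even hx]
  · simp [sgn, CliffordAlgebra.involute_eq_of_mem_odd hx]

theorem mem_of_involute {E : Type*} [AddCommGroup E] [Module ℝ E] {Q : QuadraticForm ℝ E}
    {q : ZMod 2} {x : CliffordAlgebra Q} (hx : CliffordAlgebra.involute x = sgn q • x) :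
    x ∈ CliffordAlgebra.evenOdd Q q := by
  obtain ⟨a, ha, b, hb, rfl⟩ := Submodule.mem_sup.1
    ((CliffordAlgebra.evenOdd_isCompl Q).sup_eq_top ▸ Submodule.mem_top (x := x))
  rw [map_add, CliffordAlgebra.involute_eq_of_mem_even ha,
    CliffordAlgebra.involute_eq_of_mem_odd hb] at hx
  rcases zmod2_cases q with rfl | rfl
  · have h2 : (2 : ℝ) • b = 0 := by
      simp only [sgn, if_true, one_smul] at hx
      have := add_left_cancel hx
      rw [two_smul]; nth_rewrite 1 [← this]; simp
    rw [(smul_eq_zero_iff_right two_ne_zero).1 h2, add_zero]; exact ha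
  · have h2 : (2 : ℝ) • a = 0 := by
      simp only [sgn, one_ne_zero, if_false, neg_smul, one_smul, neg_add] at hx
      have := add_right_cancel hx
      rw [two_smul]; nth_rewrite 1 [this]; simp
    rw [(smul_eq_zero_iff_right two_ne_zero).1 h2, zero_add]; exact hb

theorem contractLeft_mem {E : Type*} [AddCommGroup E] [Module ℝ E] {Q : QuadraticForm ℝ E}
    (d : Module.Dual ℝ E) {q : ZMod 2} {x : CliffordAlgebra Q}
    (hx : x ∈ CliffordAlgebra.evenOdd Q q) :
    CliffordAlgebra.contractLeft d x ∈ CliffordAlgebra.evenOdd Q (1 + q) := by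
  apply mem_of_involute
  rw [involute_contractLeft, involute_of_mem hx, map_smul, ← neg_smul]
  congr 1
  rcases zmod2_cases q with rfl | rfl
  · simp [sgn]
  · have : (1 + 1 : ZMod 2) = 0 := by decide
    simp [sgn, this]

theorem modelPd_isSuperDer (V : Opens (Fin n → ℝ)) (i : Idx n m) :
    IsSuperDer (A := Model m V) (modelGr m V) (par i) (modelPd V i) := by
  rcases i with i | j
  · refine ⟨fun q => modelGr_induction ?_ ?_ ?_, fun q => modelGr_induction ?_ ?_ ?_⟩
    · rw [map_zero]; exact zero_mem _
    · intro x y hx hy; rw [map_add]; exact add_mem hx hy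
    · intro a w hw
      simp only [par, zero_add, modelPd, LinearMap.rTensor_tmul]
      exact tmul_mem_modelGr _ hw
    · simp
    · intro x y hx hy g
      simp only [add_mul, map_add, hx, hy, smul_add]; abel
    · intro a w hw g
      simp only [par, zero_mul, sgn, if_true, one_smul]
      induction g using TensorProduct.induction_on with
      | zero => simp
      | add x y hx hy => simp only [mul_add, map_add, hx, hy]; abel
      | tmul b w' =>
        simp only [modelPd, Algebra.TensorProduct.tmul_mul_tmul, LinearMap.rTensor_tmul,
          Derivation.coeFn_coe, Derivation.leibniz, smul_eq_mul, TensorProduct.add_tmul]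
        rw [add_comm, mul_comm b]
  · refine ⟨fun q => modelGr_induction ?_ ?_ ?_, fun q => modelGr_induction ?_ ?_ ?_⟩
    · rw [map_zero]; exact zero_mem _
    · intro x y hx hy; rw [map_add]; exact add_mem hx hy
    · intro a w hw
      simp only [par, modelPd, LinearMap.lTensor_tmul]
      exact tmul_mem_modelGr _ (contractLeft_mem _ hw)
    · simp
    · intro x y hx hy g
      simp only [add_mul, map_add, hx, hy, smul_add]; abel
    · intro a w hw g
      simp only [par, one_mul]
      induction g using TensorProduct.induction_on with
      | zero => simp
      | add x y hx hy => simp only [mul_add, map_add, hx, hy, smul_add]; abel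
      | tmul b w' =>
        simp only [modelPd, Algebra.TensorProduct.tmul_mul_tmul, LinearMap.lTensor_tmul]
        rw [contractLeft_mul, involute_of_mem hw, TensorProduct.tmul_add, smul_mul_assoc,
          TensorProduct.tmul_smul]

end Model

/-! ### Supermanifolds -/

/-- A superspace: a topological space with a sheaf of supercommutative `ℤ/2`-graded
real algebras. -/
structure SuperSpace (M : Type u) [TopologicalSpace M] where
  /-- sections over `U` -/
  Sec : Opens M → Type v
  [ring : ∀ U, Ring (Sec U)]
  [algebra : ∀ U, Algebra ℝ (Sec U)]
  /-- the even (`0`) and odd (`1`) sections -/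
  gr : ∀ U, ZMod 2 → Submodule ℝ (Sec U)
  [graded : ∀ U, GradedAlgebra (gr U)]
  supercomm : ∀ U p q, ∀ f ∈ gr U p, ∀ g ∈ gr U q, f * g = sgn (p * q) • (g * f)
  /-- restriction of sections -/
  res : ∀ {U V : Opens M}, V ≤ U → Sec U →ₐ[ℝ] Sec V
  res_mem : ∀ {U V : Opens M} (h : V ≤ U) (p : ZMod 2), ∀ f ∈ gr U p, res h f ∈ gr V p
  res_self : ∀ (U : Opens M) (f : Sec U), res le_rfl f = f
  res_res : ∀ {U V W : Opens M} (h : V ≤ U) (h' : W ≤ V) (f : Sec U),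
    res h' (res h f) = res (h'.trans h) f
  glue : ∀ {ι : Type u} (U : ι → Opens M) (s : ∀ i, Sec (U i)),
    (∀ i j, res (inf_le_left : U i ⊓ U j ≤ U i) (s i) = res inf_le_right (s j)) →
      ∃! t : Sec (iSup U), ∀ i, res (le_iSup U i) t = s i

attribute [instance] SuperSpace.ring SuperSpace.algebra SuperSpace.graded

variable {M : Type u} [TopologicalSpace M]

/-- The image in `ℝ^n` of (the part in its source of) an open set under a local homeomorphism. -/
def imageOpens {n : ℕ} (e : OpenPartialHomeomorph M (Fin n → ℝ)) (W : Opens M) :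
    Opens (Fin n → ℝ) :=
  ⟨e '' (e.source ∩ W), e.isOpen_image_source_inter W.2⟩

theorem imageOpens_mono {n : ℕ} (e : OpenPartialHomeomorph M (Fin n → ℝ)) {W W' : Opens M}
    (h : W' ≤ W) : imageOpens e W' ≤ imageOpens e W :=
  Set.image_mono (Set.inter_subset_inter_right _ h)

/-- A coordinate system on the open set `dom`: an isomorphism of the superspace `dom` with an
open superdomain of dimension `n|m`, that is, a homeomorphism of `dom` onto an open set of `ℝ^n`
and a compatible isomorphism of sheaves of graded algebras. -/
structure Chart (X : SuperSpace.{u, v} M) (n m : ℕ) where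
  homeo : OpenPartialHomeomorph M (Fin n → ℝ)
  iso : ∀ W : Opens M, W ≤ ⟨homeo.source, homeo.open_source⟩ →
    X.Sec W ≃ₐ[ℝ] Model m (imageOpens homeo W)
  iso_mem : ∀ W hW p f, iso W hW f ∈ modelGr m (imageOpens homeo W) p ↔ f ∈ X.gr W p
  iso_res : ∀ {W W' : Opens M} (hW : W ≤ ⟨homeo.source, homeo.open_source⟩) (h : W' ≤ W)
    (f : X.Sec W), iso W' (h.trans hW) (X.res h f) =
      modelRes m (imageOpens_mono homeo h) (iso W hW f)

/-- The domain of a coordinate system. -/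
def Chart.dom {X : SuperSpace.{u, v} M} {n m : ℕ} (φ : Chart X n m) : Opens M :=
  ⟨φ.homeo.source, φ.homeo.open_source⟩

/-- `X` is a supermanifold of dimension `n|m`. -/
structure IsSupermanifold (X : SuperSpace.{u, v} M) (n m : ℕ) : Prop where
  t2 : T2Space M
  secondCountable : SecondCountableTopology M
  exists_chart : ∀ x : M, ∃ φ : Chart X n m, x ∈ φ.dom

variable {X : SuperSpace.{u, v} M} {n m : ℕ}

/-! ### Vector fields and one-forms -/

theorem IsSuperDer.add {W : Opens M} {p : ZMod 2} {D E : X.Sec W →ₗ[ℝ] X.Sec W}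
    (hD : IsSuperDer (X.gr W) p D) (hE : IsSuperDer (X.gr W) p E) :
    IsSuperDer (X.gr W) p (D + E) := by
  refine ⟨fun q f hf => add_mem (hD.1 q f hf) (hE.1 q f hf), fun q f hf g => ?_⟩
  simp only [LinearMap.add_apply, hD.2 q f hf g, hE.2 q f hf g, add_mul, mul_add, smul_add]
  abel

theorem IsSuperDer.zero (W : Opens M) (p : ZMod 2) :
    IsSuperDer (X.gr W) p (0 : X.Sec W →ₗ[ℝ] X.Sec W) :=
  ⟨fun _ _ _ => zero_mem _, fun _ _ _ _ => by simp⟩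

theorem sgn_add_mul (a p q : ZMod 2) : sgn ((a + p) * q) = sgn (p * q) * sgn (a * q) := by
  rcases zmod2_cases a with rfl | rfl <;> rcases zmod2_cases p with rfl | rfl <;>
    rcases zmod2_cases q with rfl | rfl <;> simp [sgn, show (1 + 1 : ZMod 2) = 0 by decide]

theorem IsSuperDer.smul {W : Opens M} {a p : ZMod 2} {f : X.Sec W} (hf : f ∈ X.gr W a)
    {D : X.Sec W →ₗ[ℝ] X.Sec W} (hD : IsSuperDer (X.gr W) p D) :
    IsSuperDer (X.gr W) (a + p) (f • D) := by
  refine ⟨fun q g hg => ?_, fun q g hg k => ?_⟩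
  · rw [add_assoc]
    exact SetLike.mul_mem_graded hf (hD.1 q g hg)
  · simp only [LinearMap.smul_apply, smul_eq_mul, hD.2 q g hg k, mul_add, mul_smul_comm]
    rw [← mul_assoc f g, X.supercomm W a q f hf g hg, smul_mul_assoc, smul_smul, sgn_add_mul,
      mul_assoc, mul_assoc]

/-- The `O(W)`-module of vector fields on `W`: sums of an even and an odd superderivation
of `O(W)`. -/
def Der (X : SuperSpace.{u, v} M) (W : Opens M) :
    Submodule (X.Sec W) (X.Sec W →ₗ[ℝ] X.Sec W) where
  carrier := {D | ∃ D₀ D₁, IsSuperDer (X.gr W) 0 D₀ ∧ IsSuperDer (X.gr W) 1 D₁ ∧ D = D₀ + D₁}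
  add_mem' := by
    rintro _ _ ⟨D₀, D₁, h₀, h₁, rfl⟩ ⟨E₀, E₁, k₀, k₁, rfl⟩
    exact ⟨D₀ + E₀, D₁ + E₁, h₀.add k₀, h₁.add k₁, by abel⟩
  zero_mem' := ⟨0, 0, IsSuperDer.zero W 0, IsSuperDer.zero W 1, by simp⟩
  smul_mem' := by
    rintro f _ ⟨D₀, D₁, h₀, h₁, rfl⟩
    classical
    have e : f = (DirectSum.decompose (X.gr W) f 0 : X.Sec W) +
        (DirectSum.decompose (X.gr W) f 1 : X.Sec W) := by
      conv_lhs => rw [← DirectSum.sum_support_decompose (X.gr W) f]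
      rw [Finset.sum_subset (Finset.subset_univ _) (fun i _ hi => by
        simpa using hi)]
      exact Fin.sum_univ_two _
    set f₀ := (DirectSum.decompose (X.gr W) f 0 : X.Sec W) with hf₀
    set f₁ := (DirectSum.decompose (X.gr W) f 1 : X.Sec W) with hf₁
    have m₀ : f₀ ∈ X.gr W 0 := SetLike.coe_mem _
    have m₁ : f₁ ∈ X.gr W 1 := SetLike.coe_mem _
    refine ⟨f₀ • D₀ + f₁ • D₁, f₀ • D₁ + f₁ • D₀, ?_, ?_, ?_⟩
    · have a := IsSuperDer.smul m₀ h₀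
      have b := IsSuperDer.smul m₁ h₁
      rw [show (1 + 1 : ZMod 2) = 0 by decide] at b
      rw [add_zero] at a
      exact a.add b
    · have a := IsSuperDer.smul m₀ h₁
      have b := IsSuperDer.smul m₁ h₀
      rw [zero_add] at a
      rw [add_zero] at b
      exact a.add b
    · rw [e, add_smul, smul_add, smul_add]; abel

theorem IsSuperDer.mem_der {W : Opens M} {p : ZMod 2} {D : X.Sec W →ₗ[ℝ] X.Sec W}
    (h : IsSuperDer (X.gr W) p D) : D ∈ Der X W := by
  rcases zmod2_cases p with rfl | rfl
  · exact ⟨D, 0, h, IsSuperDer.zero W 1, by simp⟩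
  · exact ⟨0, D, IsSuperDer.zero W 0, h, by simp⟩

/-- The vector field `D` has parity `p`. -/
def Der.HasParity {W : Opens M} (p : ZMod 2) (D : Der X W) : Prop := IsSuperDer (X.gr W) p D.1

/-- The vector field `D'` on `W' ⊆ W` is the restriction of the vector field `D` on `W`. -/
def Der.Restricts {W W' : Opens M} (h : W' ≤ W) (D : Der X W) (D' : Der X W') : Prop :=
  ∀ f, X.res h (D.1 f) = D'.1 (X.res h f)

/-- One-forms on `U`: left linear maps from vector fields to functions, on all open subsets
of `U` and compatible with restriction. -/
@[ext]
structure OneForm (X : SuperSpace.{u, v} M) (U : Opens M) where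
  app : ∀ W : Opens M, W ≤ U → (Der X W →ₗ[X.Sec W] X.Sec W)
  natural : ∀ {W W' : Opens M} (hW : W ≤ U) (h : W' ≤ W) (D : Der X W) (D' : Der X W'),
    Der.Restricts h D D' → X.res h (app W hW D) = app W' (h.trans hW) D'

namespace OneForm

variable {U : Opens M}

instance : Add (OneForm X U) where
  add ω η := ⟨fun W hW => ω.app W hW + η.app W hW, fun hW h D D' r => by
    simp only [LinearMap.add_apply, map_add, ω.natural hW h D D' r, η.natural hW h D D' r]⟩

/-- The right multiple `ω f` of a one-form by a function: `(ω f)(D) = ω(D) f`. (The left multiple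
is `f ω = (-1)^{f̃ ω̃} ω f`.) -/
def mulRight (ω : OneForm X U) (f : X.Sec U) : OneForm X U where
  app W hW :=
    { toFun := fun D => ω.app W hW D * X.res hW f
      map_add' := fun D E => by rw [map_add, add_mul]
      map_smul' := fun g D => by
        rw [map_smul, smul_eq_mul, mul_assoc, RingHom.id_apply, smul_eq_mul] }
  natural hW h D D' r := by
    change X.res h (ω.app _ hW D * X.res hW f) = _ * X.res (h.trans hW) f
    rw [map_mul, ω.natural hW h D D' r, X.res_res]

/-- The restriction of a one-form. -/
def restrict {V : Opens M} (h : V ≤ U) (ω : OneForm X U) : OneForm X V where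
  app W hW := ω.app W (hW.trans h)
  natural hW h' D D' r := ω.natural (hW.trans h) h' D D' r

/-- The differential of a function: `(df)(D) = D f`. -/
def d (f : X.Sec U) : OneForm X U where
  app W hW :=
    { toFun := fun D => D.1 (X.res hW f)
      map_add' := fun _ _ => rfl
      map_smul' := fun _ _ => rfl }
  natural hW h D D' r := by
    change X.res h (D.1 (X.res hW f)) = D'.1 (X.res (h.trans hW) f)
    rw [r, X.res_res]

/-- The one-form `ω` has parity `q`. -/
def HasParity (q : ZMod 2) (ω : OneForm X U) : Prop :=
  ∀ (W : Opens M) (hW : W ≤ U) (p : ZMod 2) (D : Der X W), Der.HasParity p D →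
    ω.app W hW D ∈ X.gr W (p + q)

end OneForm

/-- A supersymmetric contravariant tensor field `S` of rank two and of parity `ε`, as a
bilinear form on one-forms. -/
structure SymTensor (X : SuperSpace.{u, v} M) (ε : ZMod 2) where
  app : ∀ U : Opens M, OneForm X U → OneForm X U → X.Sec U
  add_left : ∀ U ω ω' η, app U (ω + ω') η = app U ω η + app U ω' η
  add_right : ∀ U ω η η', app U ω (η + η') = app U ω η + app U ω η'
  mul_right : ∀ U ω η f, app U ω (η.mulRight f) = app U ω η * f
  symm : ∀ U p q ω η, ω.HasParity p → η.HasParity q → app U ω η = sgn (p * q) • app U η ω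
  parity : ∀ U p q ω η, ω.HasParity p → η.HasParity q → app U ω η ∈ X.gr U (ε + p + q)
  natural : ∀ {U V : Opens M} (h : V ≤ U) ω η,
    X.res h (app U ω η) = app V (ω.restrict h) (η.restrict h)

/-- A symmetric (that is, torsion-free) linear connection on the tangent bundle. -/
structure SymConnection (X : SuperSpace.{u, v} M) where
  cov : ∀ U : Opens M, Der X U → Der X U → Der X U
  add_left : ∀ U D D' E, cov U (D + D') E = cov U D E + cov U D' E
  smul_left : ∀ U (f : X.Sec U) D E, cov U (f • D) E = f • cov U D E
  add_right : ∀ U D E E', cov U D (E + E') = cov U D E + cov U D E'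
  leibniz : ∀ U p a (D : Der X U) (f : X.Sec U) (E : Der X U), Der.HasParity p D → f ∈ X.gr U a →
    cov U D (f • E) = D.1 f • E + sgn (p * a) • (f • cov U D E)
  parity : ∀ U p q (D E : Der X U), Der.HasParity p D → Der.HasParity q E →
    Der.HasParity (p + q) (cov U D E)
  torsion_free : ∀ U p q (D E : Der X U), Der.HasParity p D → Der.HasParity q E → ∀ f,
    (cov U D E).1 f - sgn (p * q) • (cov U E D).1 f =
      D.1 (E.1 f) - sgn (p * q) • E.1 (D.1 f)
  natural : ∀ {U V : Opens M} (h : V ≤ U) (D E : Der X U) (D' E' : Der X V),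
    Der.Restricts h D D' → Der.Restricts h E E' → Der.Restricts h (cov U D E) (cov V D' E')

/-! ### Coordinate expressions -/

namespace Chart

/-- The coordinate functions `x^i`. -/
def coord (φ : Chart X n m) {W : Opens M} (hW : W ≤ φ.dom) (i : Idx n m) : X.Sec W :=
  (φ.iso W hW).symm (modelCoord _ i)

/-- The (left) partial derivative `∂_i`, as a linear map. -/
def pdLin (φ : Chart X n m) {W : Opens M} (hW : W ≤ φ.dom) (i : Idx n m) :
    X.Sec W →ₗ[ℝ] X.Sec W :=
  (φ.iso W hW).symm.toLinearMap ∘ₗ modelPd _ i ∘ₗ (φ.iso W hW).toLinearMap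

theorem pdLin_isSuperDer (φ : Chart X n m) {W : Opens M} (hW : W ≤ φ.dom) (i : Idx n m) :
    IsSuperDer (X.gr W) (par i) (φ.pdLin hW i) := by
  obtain ⟨h1, h2⟩ := modelPd_isSuperDer (m := m) (imageOpens φ.homeo W) i
  refine ⟨fun q f hf => ?_, fun q f hf g => ?_⟩
  · rw [← φ.iso_mem W hW]
    have := h1 q _ ((φ.iso_mem W hW q f).2 hf)
    simpa [pdLin] using this
  · have := h2 q _ ((φ.iso_mem W hW q f).2 hf) (φ.iso W hW g)
    apply (φ.iso W hW).injective
    simpa [pdLin] using this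

/-- The coordinate vector field `∂_i`. -/
def pd (φ : Chart X n m) {W : Opens M} (hW : W ≤ φ.dom) (i : Idx n m) : Der X W :=
  ⟨φ.pdLin hW i, (φ.pdLin_isSuperDer hW i).mem_der⟩

/-- The components `S^{ij} = S(dx^i, dx^j)` of a tensor field. -/
def tensorCoeff (φ : Chart X n m) {W : Opens M} (hW : W ≤ φ.dom) {ε : ZMod 2}
    (S : SymTensor X ε) (i j : Idx n m) : X.Sec W :=
  S.app W (OneForm.d (φ.coord hW i)) (OneForm.d (φ.coord hW j))

/-- The coefficients `Γ^k_{ij}` of a connection, `∇_{∂_i} ∂_j = Γ^k_{ij} ∂_k`. -/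
def christoffel (φ : Chart X n m) {W : Opens M} (hW : W ≤ φ.dom) (C : SymConnection X)
    (i j k : Idx n m) : X.Sec W :=
  (C.cov W (φ.pd hW i) (φ.pd hW j)).1 (φ.coord hW k)

/-- The trace-free part of the connection coefficients,
`Π^k_{ji} = Γ^k_{ji} - (Γ^s_{js} δ^k_i (-1)^s + Γ^s_{is} δ^k_j (-1)^{ij+s}) / (n - m + 1)`;
the value is `φ.thomas hW C j i k`. -/
def thomas (φ : Chart X n m) {W : Opens M} (hW : W ≤ φ.dom) (C : SymConnection X)
    (j i k : Idx n m) : X.Sec W :=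
  φ.christoffel hW C j i k - ((n : ℝ) - m + 1)⁻¹ •
    ((if k = i then ∑ s, sgn (par s) • φ.christoffel hW C j s s else 0) +
      (if k = j then ∑ s, sgn (par i * par j + par s) • φ.christoffel hW C i s s else 0))

end Chart

/-- Two symmetric connections are projectively equivalent if in all coordinate systems they have
the same `Π^k_{ji}`. -/
def projSetoid (X : SuperSpace.{u, v} M) (n m : ℕ) : Setoid (SymConnection X) where
  r C C' := ∀ (φ : Chart X n m) (W : Opens M) (hW : W ≤ φ.dom) (j i k : Idx n m),
    φ.thomas hW C j i k = φ.thomas hW C' j i k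
  iseqv :=
    { refl := fun _ _ _ _ _ _ _ => rfl
      symm := fun h φ W hW j i k => (h φ W hW j i k).symm
      trans := fun h h' φ W hW j i k => (h φ W hW j i k).trans (h' φ W hW j i k) }

/-- A projective class on an `n|m`-dimensional supermanifold. -/
def ProjectiveClass (X : SuperSpace.{u, v} M) (n m : ℕ) : Type (max u v) :=
  Quotient (projSetoid X n m)

namespace Chart

/-- The coefficients `Π^k_{ji}` of a projective class; the value is `φ.projCoeff hW P j i k`. -/
def projCoeff (φ : Chart X n m) {W : Opens M} (hW : W ≤ φ.dom) (P : ProjectiveClass X n m)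
    (j i k : Idx n m) : X.Sec W :=
  Quotient.lift (fun C => φ.thomas hW C j i k)
    (fun C C' h => (show (projSetoid X n m).r C C' from h) φ W hW j i k) P

/-- `∂_j S^{ji} (-1)^{j(S + 1)}`. -/
def divTensor (φ : Chart X n m) {W : Opens M} (hW : W ≤ φ.dom) {ε : ZMod 2}
    (S : SymTensor X ε) (i : Idx n m) : X.Sec W :=
  ∑ j, sgn (par j * (ε + 1)) • (φ.pd hW j).1 (φ.tensorCoeff hW S j i)

/-- `S^{jk} Π^i_{kj}`. -/
def contractTensor (φ : Chart X n m) {W : Opens M} (hW : W ≤ φ.dom) {ε : ZMod 2}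
    (S : SymTensor X ε) (P : ProjectiveClass X n m) (i : Idx n m) : X.Sec W :=
  ∑ j, ∑ k, φ.tensorCoeff hW S j k * φ.projCoeff hW P k j i

/-- The coordinate expression of the projective Laplacian applied to `f`. -/
def laplacian (φ : Chart X n m) {W : Opens M} (hW : W ≤ φ.dom) {ε : ZMod 2}
    (S : SymTensor X ε) (P : ProjectiveClass X n m) (f : X.Sec W) : X.Sec W :=
  (∑ i, ∑ j, φ.tensorCoeff hW S i j * (φ.pd hW j).1 ((φ.pd hW i).1 f)) +
    ∑ i, ((2 / ((n : ℝ) - m + 3)) • φ.divTensor hW S i -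
      (((n : ℝ) - m + 1) / ((n : ℝ) - m + 3)) • φ.contractTensor hW S P i) * (φ.pd hW i).1 f

/-- The coefficients `γ^i` of the upper volume connection. -/
def upperCoeff (φ : Chart X n m) {W : Opens M} (hW : W ≤ φ.dom) {ε : ZMod 2}
    (S : SymTensor X ε) (P : ProjectiveClass X n m) (i : Idx n m) : X.Sec W :=
  (((n : ℝ) - m + 1) / ((n : ℝ) - m + 3)) •
    (φ.divTensor hW S i + φ.contractTensor hW S P i)

end Chart

/-- A linear operator on functions that is compatible with restriction. -/
@[ext]
structure Operator (X : SuperSpace.{u, v} M) where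
  app : ∀ U : Opens M, X.Sec U →ₗ[ℝ] X.Sec U
  natural : ∀ {U V : Opens M} (h : V ≤ U) (f : X.Sec U),
    X.res h (app U f) = app V (X.res h f)

/-! ### The Berezinian and volume forms -/

/-- Even sections form a commutative ring. -/
instance evenCommRing (X : SuperSpace.{u, v} M) (W : Opens M) : CommRing (X.gr W 0) where
  mul_comm a b := by
    ext
    have := X.supercomm W 0 0 a a.2 b b.2
    simpa [sgn] using this

/-- The even part of a section. -/
def evenPart {W : Opens M} (f : X.Sec W) : X.gr W 0 := DirectSum.decompose (X.gr W) f 0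

/-- The Berezinian `det (A - B D⁻¹ C) / det D` of an even supermatrix with blocks
`A`, `B`, `C`, `D` (the entries of `A`, `D` and `A - B D⁻¹ C` are even and `D` is invertible). -/
def berezinian {W : Opens M} (T : Matrix (Idx n m) (Idx n m) (X.Sec W)) : X.gr W 0 :=
  let Dinv : Matrix (Fin m) (Fin m) (X.gr W 0) := (T.toBlocks₂₂.map evenPart)⁻¹
  ((T.toBlocks₁₁ - T.toBlocks₁₂ * Dinv.map Subtype.val * T.toBlocks₂₁).map evenPart).det *
    Dinv.det

/-- The Berezinian of the matrix `∂y^a/∂x^i` of the change from the coordinates `x` of `φ` to the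
coordinates `y` of `ψ`. -/
def berJacobian (φ ψ : Chart X n m) {W : Opens M} (hφ : W ≤ φ.dom) (hψ : W ≤ ψ.dom) : X.Sec W :=
  (berezinian (Matrix.of fun i a : Idx n m => (φ.pd hφ i).1 (ψ.coord hψ a))).1

theorem even_comm {W : Opens M} (e : X.gr W 0) (g : X.Sec W) : e.1 * g = g * e.1 := by
  induction g using DirectSum.Decomposition.inductionOn (X.gr W) with
  | zero => simp
  | homogeneous g =>
    have := X.supercomm W 0 _ e.1 e.2 g.1 g.2
    simpa [sgn] using this
  | add a b ha hb => rw [mul_add, add_mul, ha, hb]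

/-- Sections over `U` of the bundle of volume forms (the Berezinian bundle): the section is `s Dx`
in the coordinates `x` of `φ`, with `s = comp φ`, and `Dy = Ber(∂y/∂x) Dx`. -/
@[ext]
structure VolumeForm (X : SuperSpace.{u, v} M) (n m : ℕ) (U : Opens M) where
  comp : ∀ (φ : Chart X n m) (W : Opens M), W ≤ U → W ≤ φ.dom → X.Sec W
  natural : ∀ (φ : Chart X n m) {W W' : Opens M} (hU : W ≤ U) (hφ : W ≤ φ.dom) (h : W' ≤ W),
    X.res h (comp φ W hU hφ) = comp φ W' (h.trans hU) (h.trans hφ)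
  transition : ∀ (φ ψ : Chart X n m) (W : Opens M) (hU : W ≤ U) (hφ : W ≤ φ.dom)
    (hψ : W ≤ ψ.dom), comp φ W hU hφ = berJacobian φ ψ hφ hψ * comp ψ W hU hψ

namespace VolumeForm

variable {U : Opens M}

instance : Add (VolumeForm X n m U) where
  add σ τ :=
    { comp := fun φ W hU hφ => σ.comp φ W hU hφ + τ.comp φ W hU hφ
      natural := fun φ W W' hU hφ h => by rw [map_add, σ.natural, τ.natural]
      transition := fun φ ψ W hU hφ hψ => by
        rw [mul_add, σ.transition φ ψ W hU hφ hψ, τ.transition φ ψ W hU hφ hψ] }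

instance : SMul (X.Sec U) (VolumeForm X n m U) where
  smul g σ :=
    { comp := fun φ W hU hφ => X.res hU g * σ.comp φ W hU hφ
      natural := fun φ W W' hU hφ h => by rw [map_mul, σ.natural, X.res_res]
      transition := fun φ ψ W hU hφ hψ => by
        rw [σ.transition φ ψ W hU hφ hψ, ← mul_assoc, ← mul_assoc, berJacobian, even_comm] }

instance : SMul ℝ (VolumeForm X n m U) where
  smul r σ := algebraMap ℝ (X.Sec U) r • σ

/-- The restriction of a volume form. -/
def restrict {V : Opens M} (h : V ≤ U) (σ : VolumeForm X n m U) : VolumeForm X n m V where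
  comp φ W hV hφ := σ.comp φ W (hV.trans h) hφ
  natural φ _ _ hV hφ h' := σ.natural φ (hV.trans h) hφ h'
  transition φ ψ W hV hφ hψ := σ.transition φ ψ W (hV.trans h) hφ hψ

/-- The volume form `s Dx` has parity `q`, where `Dx` is taken to be even. -/
def HasParity (q : ZMod 2) (σ : VolumeForm X n m U) : Prop :=
  ∀ φ W hU hφ, σ.comp φ W hU hφ ∈ X.gr W q

end VolumeForm

/-- An upper connection (contravariant derivative) over `S` in the bundle of volume forms. It has
the parity `ε` of `S`; `linear` says that `∇^{f ω} σ = (-1)^{ε f} f ∇^ω σ`. -/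
@[ext]
structure UpperConnection {X : SuperSpace.{u, v} M} (n m : ℕ) {ε : ZMod 2}
    (S : SymTensor X ε) where
  app : ∀ U : Opens M, OneForm X U → VolumeForm X n m U → VolumeForm X n m U
  add_left : ∀ U ω ω' σ, app U (ω + ω') σ = app U ω σ + app U ω' σ
  add_right : ∀ U ω σ τ, app U ω (σ + τ) = app U ω σ + app U ω τ
  linear : ∀ U a q (f : X.Sec U) (ω : OneForm X U) σ, f ∈ X.gr U a → ω.HasParity q →
    app U (ω.mulRight f) σ = sgn (a * (q + ε)) • (f • app U ω σ)
  leibniz : ∀ U a q (f : X.Sec U) (ω : OneForm X U) σ, f ∈ X.gr U a → ω.HasParity q →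
    app U ω (f • σ) =
      S.app U ω (OneForm.d f) • σ + sgn (a * (q + ε)) • (f • app U ω σ)
  parity : ∀ U q b (ω : OneForm X U) (σ : VolumeForm X n m U), ω.HasParity q →
    σ.HasParity b → (app U ω σ).HasParity (ε + q + b)
  natural : ∀ {U V : Opens M} (h : V ≤ U) ω σ,
    (app U ω σ).restrict h = app V (ω.restrict h) (σ.restrict h)

/-- The upper connection `K` has the coefficients `γ^i` in coordinates:
`∇^{dx^i} (s Dx) = (S^{ij} ∂_j s + γ^i s) Dx`; in particular `∇^{dx^i} Dx = γ^i Dx`. -/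
def UpperConnection.HasCoeffs {ε : ZMod 2} {S : SymTensor X ε} (K : UpperConnection n m S)
    (φ : Chart X n m) {W : Opens M} (hW : W ≤ φ.dom) (γ : Idx n m → X.Sec W) : Prop :=
  ∀ (i : Idx n m) (σ : VolumeForm X n m W),
    (K.app W (OneForm.d (φ.coord hW i)) σ).comp φ W le_rfl hW =
      (∑ j, φ.tensorCoeff hW S i j * (φ.pd hW j).1 (σ.comp φ W le_rfl hW)) +
        γ i * σ.comp φ W le_rfl hW

end

end Supergeometry

open scoped TensorProduct
open TopologicalSpace

namespace Supergeometry

universe u v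

noncomputable section

/-! ### Hadamard's lemma on open subsets of `ℝ^n` -/

section Hadamard

open scoped ContDiff
open MeasureTheory

/-! Write `N = n - m`. A projective class is represented by a symmetric connection with coefficients
`Γ`; put `τ_i = Γ^s_{is} (-1)^s`. Since `S` is supersymmetric, both trace terms of `Π` contribute
equally to its contraction with `S`, so `S^{jk} Π^i_{kj} = S^{jk} Γ^i_{kj} - 2/(N+1) S^{ij} τ_j`.
Let `V^i = ∂_j S^{ji} (-1)^{j(S+1)} + S^{jk} Γ^i_{kj} + S^{ij} τ_j` be the covariant divergence of
`S`. Collecting terms, the Laplacian becomes `S^{ij} (∂_j ∂_i - Γ^k_{ji} ∂_k) + 2/(N+3) V^i ∂_i`,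
and the coefficients of the upper connection become `γ^i = (N+1)/(N+3) V^i - S^{ij} τ_j`
(`laplacian_mk`, `upperCoeff_mk`). Three facts about a single connection then suffice.

The trace of the Hessian against `S` does not depend on the chart, because the Hessian is tensorial
in both vector fields (`hessTrace_eq`).

Nor does `V`. For homogeneous `f`, the supertrace of `D ↦ ∇_D (S(df, ·))` equals `V f` plus the
trace of the Hessian of `f` (`covDiv_add_hessTrace`). The supertrace of a left linear operator is
invariant (`superTrace_eq`), so `V f` is a difference of invariants.

The form `dx^i τ_i` is not invariant: it changes by the logarithmic differential of the Berezinian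
of the Jacobian (`traceForm_transition`). This is the super Jacobi formula `D Ber T = str(DT · T⁻¹)
Ber T` (`map_berezinian`) combined with the transformation law of `Γ`. The term `-S^{ij} τ_j`
therefore compensates the derivative of the transition function of the volume bundle, and `∇^ω (s
Dx) = (S(ω, ds) + (r ω(V) - S(ω, τ)) s) Dx` is well defined for every real `r`
(`upperOp_transition`).

All of this rests on expanding a vector field as `D = D(x^i) ∂_i`, that is, on a superderivation
being determined by its values on the coordinates; for the even coordinates this is Hadamard's
lemma. Local operators are glued by the sheaf property. An upper connection is determined by its
values on the `dx^i`, since these generate the one-forms in a chart. -/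

theorem contDiff_intervalIntegral_param {E F : Type*} [NormedAddCommGroup E] [NormedSpace ℝ E]
    [NormedAddCommGroup F] [NormedSpace ℝ F] [CompleteSpace F] {H : E → ℝ → F}
    (hH : ContDiff ℝ ∞ (Function.uncurry H)) :
    ContDiff ℝ ∞ (fun x => ∫ t in (0 : ℝ)..1, H x t) := by
  -- The integral is the value at `0` of the convolution of the indicator of `(0, 1]` with `s ↦ χ s
  -- • H x (-s)`, and smoothness of convolutions in a parameter applies. The bump supplies the
  -- compact support; its inner radius `1` makes it equal to `1` at every `-t` with `t ∈ (0, 1]`.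
  let χ : ContDiffBump (0 : ℝ) := ⟨1, 2, one_pos, one_lt_two⟩
  let g : E → ℝ → F := fun p s => χ s • H p (-s)
  have hf : LocallyIntegrable (Set.indicator (Set.Ioc (0 : ℝ) 1) (1 : ℝ → ℝ)) volume :=
    ((integrable_indicator_iff measurableSet_Ioc).2
      (integrableOn_const (by simp))).locallyIntegrable
  have hg : ContDiffOn ℝ ∞ (Function.uncurry g) (Set.univ ×ˢ Set.univ) := by
    refine (ContDiff.smul (χ.contDiff.comp contDiff_snd) (hH.comp
      (contDiff_fst.prodMk contDiff_snd.neg))).contDiffOn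
  have hk : ∀ p : E, ∀ x : ℝ, p ∈ Set.univ → x ∉ Metric.closedBall (0 : ℝ) 2 → g p x = 0 := by
    intro p x _ hx
    have : χ x = 0 := χ.zero_of_le_dist (by
      simp only [Metric.mem_closedBall, not_le] at hx
      exact hx.le)
    simp [g, this]
  have := contDiffOn_convolution_right_with_param_comp (n := ⊤) (μ := volume)
    (ContinuousLinearMap.lsmul ℝ ℝ) (contDiffOn_const (c := (0 : ℝ))) isOpen_univ
    (isCompact_closedBall (0 : ℝ) 2) hk hf hg
  rw [contDiffOn_univ] at this
  convert this using 2 with x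
  rw [intervalIntegral.integral_of_le zero_le_one, convolution_def,
    ← integral_indicator measurableSet_Ioc]
  refine integral_congr_ae (Filter.Eventually.of_forall fun t => ?_)
  by_cases ht : t ∈ Set.Ioc (0 : ℝ) 1
  · have : χ (-t) = 1 := χ.one_of_mem_closedBall (by
      simp only [Metric.mem_closedBall, dist_zero_right, norm_neg, Real.norm_eq_abs]
      exact (abs_of_pos ht.1).le.trans ht.2)
    simp [ht, g, this]
  · simp [ht]

/-- Integrate the derivative of `F` along the segment from `p` to `x` and expand the direction `x -
p` in the standard basis. -/
theorem exists_contDiff_eq_add_sum {n : ℕ} {F : (Fin n → ℝ) → ℝ} (hF : ContDiff ℝ ∞ F)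
    (p : Fin n → ℝ) : ∃ G : Fin n → (Fin n → ℝ) → ℝ, (∀ i, ContDiff ℝ ∞ (G i)) ∧
      ∀ x, F x = F p + ∑ i, (x i - p i) * G i x := by
  have hd : ContDiff ℝ ∞ (fderiv ℝ F) := hF.fderiv_right (by simp)
  have hc : ∀ i : Fin n, ContDiff ℝ ∞ (Function.uncurry fun (x : Fin n → ℝ) (t : ℝ) =>
      fderiv ℝ F (p + t • (x - p)) (Pi.single i 1)) := fun i => by
    refine ContDiff.clm_apply (hd.comp ?_) contDiff_const
    exact contDiff_const.add (contDiff_snd.smul (contDiff_fst.sub contDiff_const))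
  refine ⟨fun i x => ∫ t in (0 : ℝ)..1, fderiv ℝ F (p + t • (x - p)) (Pi.single i 1),
    fun i => contDiff_intervalIntegral_param (hc i), fun x => ?_⟩
  have hder : ∀ t : ℝ, HasDerivAt (fun t : ℝ => F (p + t • (x - p)))
      (fderiv ℝ F (p + t • (x - p)) (x - p)) t := fun t => by
    have h1 : HasDerivAt (fun t : ℝ => p + t • (x - p)) (x - p) t := by
      simpa using ((hasDerivAt_id t).smul_const (x - p)).const_add p
    exact ((hF.differentiable (by simp)).differentiableAt.hasFDerivAt).comp_hasDerivAt t h1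
  have hci : ∀ i : Fin n, Continuous fun t : ℝ =>
      fderiv ℝ F (p + t • (x - p)) (Pi.single i 1) := fun i =>
    (hc i).continuous.comp (continuous_const.prodMk continuous_id)
  have hsum : ∀ t : ℝ, fderiv ℝ F (p + t • (x - p)) (x - p) =
      ∑ i, (x i - p i) * fderiv ℝ F (p + t • (x - p)) (Pi.single i 1) := fun t => by
    generalize fderiv ℝ F (p + t • (x - p)) = L
    conv_lhs => rw [← Finset.univ_sum_single (x - p), map_sum]
    refine Finset.sum_congr rfl fun i _ => ?_
    rw [← smul_eq_mul, ← map_smul, ← Pi.single_smul, smul_eq_mul, mul_one, Pi.sub_apply]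
  have hint := intervalIntegral.integral_eq_sub_of_hasDerivAt (a := 0) (b := 1)
    (fun t _ => hder t) (by
      simp_rw [hsum]
      exact (continuous_finsetSum _ fun i _ =>
        continuous_const.mul (hci i)).intervalIntegrable _ _)
  simp only [one_smul, add_sub_cancel, zero_smul, add_zero] at hint
  simp_rw [hsum] at hint
  have hii : ∀ i ∈ Finset.univ, IntervalIntegrable (fun t : ℝ =>
      (x i - p i) * fderiv ℝ F (p + t • (x - p)) (Pi.single i 1)) volume 0 1 := fun i _ =>
    (continuous_const.mul (hci i)).intervalIntegrable _ _
  rw [intervalIntegral.integral_finsetSum hii] at hint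
  simp_rw [intervalIntegral.integral_const_mul] at hint
  rw [hint]; ring

variable {n : ℕ}

/-- The restriction of a smooth function on `ℝ^n` to an open subset. -/
def smoothOfContDiff (V : Opens (Fin n → ℝ)) {F : (Fin n → ℝ) → ℝ} (hF : ContDiff ℝ ∞ F) :
    smoothFun V :=
  ⟨fun x => F x.1, hF.contDiffOn.congr (extZero_congr fun _ => rfl)⟩

/-- `V` need not be star-shaped, so `f` is first cut off to a function on all of `ℝ^n`. The error
vanishes near `p` and is recorded as a product of two functions vanishing at `p`, which the Leibniz
rule annihilates at `p`. -/
theorem exists_smoothFun_decomposition {V : Opens (Fin n → ℝ)} (f : smoothFun V) (p : V) :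
    ∃ (g : Fin n → smoothFun V) (h k : smoothFun V), h.1 p = 0 ∧ k.1 p = 0 ∧
      f = algebraMap ℝ _ (f.1 p) +
        ∑ i, (smoothCoord V i - algebraMap ℝ _ (p.1 i)) * g i + h * k := by
  obtain ⟨r, hr, hrV⟩ := Metric.isOpen_iff.1 V.2 p.1 p.2
  -- The closed ball of radius `r / 2` lies in `V`, so `χ f` extends smoothly by zero. As `χ = 1` on
  -- the ball of radius `r / 4`, outside of which `χ'` vanishes, `(f - χ f) χ' = 0`, that is, `f - χ
  -- f = (f - χ f)(1 - χ')`.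
  let χ : ContDiffBump p.1 := ⟨r / 4, r / 2, by positivity, by linarith⟩
  let χ' : ContDiffBump p.1 := ⟨r / 8, r / 4, by positivity, by linarith⟩
  have hF : ContDiff ℝ ∞ (fun x => χ x * extZero V f.1 x) := by
    rw [contDiff_iff_contDiffAt]
    intro x
    by_cases hx : x ∈ V
    · exact χ.contDiff.contDiffAt.mul (ContDiffOn.contDiffAt f.2 (V.2.mem_nhds hx))
    · have hx' : x ∈ (Metric.closedBall p.1 (r / 2))ᶜ := fun h => hx (hrV (by
        rw [Metric.mem_closedBall] at h
        rw [Metric.mem_ball]; linarith))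
      refine (contDiffAt_const (c := (0 : ℝ))).congr_of_eventuallyEq ?_
      filter_upwards [Metric.isClosed_closedBall.isOpen_compl.mem_nhds hx'] with y hy
      rw [χ.zero_of_le_dist (by
        rw [Set.mem_compl_iff, Metric.mem_closedBall, not_le] at hy; exact hy.le), zero_mul]
  obtain ⟨G, hG, hFG⟩ := exists_contDiff_eq_add_sum hF p.1
  refine ⟨fun i => smoothOfContDiff V (hG i), f - smoothOfContDiff V hF,
    1 - smoothOfContDiff V χ'.contDiff, ?_, ?_, ?_⟩
  · change f.1 p - χ p.1 * extZero V f.1 p.1 = 0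
    rw [χ.one_of_mem_closedBall (Metric.mem_closedBall_self χ.rIn_pos.le), extZero_apply]; ring
  · change 1 - χ' p.1 = 0
    rw [χ'.one_of_mem_closedBall (Metric.mem_closedBall_self χ'.rIn_pos.le), sub_self]
  · have key : f = smoothOfContDiff V hF +
        (f - smoothOfContDiff V hF) * (1 - smoothOfContDiff V χ'.contDiff) := by
      ext x
      change f.1 x = χ x.1 * extZero V f.1 x.1 +
        (f.1 x - χ x.1 * extZero V f.1 x.1) * (1 - χ' x.1)
      rw [extZero_apply]
      by_cases hx : x.1 ∈ Metric.closedBall p.1 (r / 4)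
      · rw [χ.one_of_mem_closedBall hx]; ring
      · rw [χ'.zero_of_le_dist (by
          rw [Metric.mem_closedBall, not_le] at hx; exact hx.le)]; ring
    have h2 : smoothOfContDiff V hF = algebraMap ℝ _ (f.1 p) +
        ∑ i, (smoothCoord V i - algebraMap ℝ _ (p.1 i)) * smoothOfContDiff V (hG i) := by
      ext x
      have := hFG x.1
      rw [χ.one_of_mem_closedBall (Metric.mem_closedBall_self χ.rIn_pos.le),
        extZero_apply V f.1 p, one_mul] at this
      refine this.trans ?_
      rw [Subalgebra.coe_add, Pi.add_apply, AddSubmonoidClass.coe_finsetSum, Finset.sum_apply]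
      rfl
    rw [← h2]; exact key

end Hadamard

theorem IsSuperDer.map_one {A : Type*} [Ring A] [Algebra ℝ A] {gr : ZMod 2 → Submodule ℝ A}
    {p : ZMod 2} {D : A →ₗ[ℝ] A} (hD : IsSuperDer gr p D) (h1 : (1 : A) ∈ gr 0) : D 1 = 0 := by
  have := hD.2 0 1 h1 1
  simpa [sgn] using this

/-! ### Superderivations of the model superdomains -/

section ModelDer

variable {n m : ℕ} {V : Opens (Fin n → ℝ)}

/-- Evaluation of a smooth function at a point. -/
def smoothEval (p : V) : smoothFun V →ₐ[ℝ] ℝ :=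
  (Pi.evalAlgHom ℝ (fun _ => ℝ) p).comp (smoothFun V).val

/-- Evaluation of the coefficients of a superfunction at a point. -/
def modelEval (m : ℕ) (p : V) : Model m V →ₐ[ℝ] ExteriorAlgebra ℝ (Fin m → ℝ) :=
  (Algebra.TensorProduct.lid ℝ (ExteriorAlgebra ℝ (Fin m → ℝ))).toAlgHom.comp
    (Algebra.TensorProduct.map (smoothEval p) (AlgHom.id ℝ _))

theorem modelEval_tmul (p : V) (a : smoothFun V) (w : ExteriorAlgebra ℝ (Fin m → ℝ)) :
    modelEval m p (a ⊗ₜ w) = a.1 p • w := rfl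

/-- In a basis of the exterior algebra the coefficients are functions on `V`, hence determined by
their values. Evaluation keeps the odd coordinates, so no nilpotent part is lost. -/
theorem model_eq_zero_of_eval {t : Model m V} (h : ∀ p : V, modelEval m p t = 0) : t = 0 := by
  let b := Module.Free.chooseBasis ℝ (ExteriorAlgebra ℝ (Fin m → ℝ))
  have key : ∀ (t : Model m V) (p : V) c, (TensorProduct.equivFinsuppOfBasisRight b t c).1 p =
      b.repr (modelEval m p t) c := by
    intro t p c
    induction t using TensorProduct.induction_on with
    | zero => simp
    | tmul a w =>
      rw [TensorProduct.equivFinsuppOfBasisRight_apply_tmul_apply, modelEval_tmul]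
      simp [mul_comm]
    | add x y hx hy =>
      rw [map_add, map_add, map_add, Finsupp.add_apply, Finsupp.add_apply, ← hx, ← hy]
      rfl
  apply (TensorProduct.equivFinsuppOfBasisRight b).injective
  ext c p
  rw [key, h, map_zero, map_zero]
  rfl

theorem one_mem_modelGr : (1 : Model m V) ∈ modelGr m V 0 :=
  tmul_mem_modelGr 1 (CliffordAlgebra.one_le_evenOdd_zero 0 (by simp))

theorem modelCoord_mem (i : Idx n m) : modelCoord V i ∈ modelGr m V (par i) := by
  rcases i with i | j
  · exact tmul_mem_modelGr _ (CliffordAlgebra.one_le_evenOdd_zero 0 (by simp))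
  · exact tmul_mem_modelGr _ (CliffordAlgebra.ι_mem_evenOdd_one 0 _)

theorem modelPd_coord (i j : Idx n m) :
    modelPd V i (modelCoord V j) = if j = i then 1 else 0 := by
  rcases i with i | i <;> rcases j with j | j
  · have : smoothPd V i (smoothCoord V j) = if j = i then 1 else 0 := by
      ext x
      change fderiv ℝ (extZero V _) x.1 _ = _
      rw [fderiv_extZero (f := (smoothCoord V j).1)
        (g := ContinuousLinearMap.proj (R := ℝ) (φ := fun _ : Fin n => ℝ) j)
        (fun x => rfl), ContinuousLinearMap.fderiv]
      by_cases h : j = i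
      · subst h; simp
      · simp [h]
    simp only [modelPd, modelCoord, LinearMap.rTensor_tmul, Derivation.coeFn_coe, this,
      Sum.inl.injEq]
    split_ifs
    · rfl
    · simp
  · simp [modelPd, modelCoord]
  · simp [modelPd, modelCoord, CliffordAlgebra.contractLeft_one]
  · simp only [modelPd, modelCoord, LinearMap.lTensor_tmul, ExteriorAlgebra.ι,
      CliffordAlgebra.contractLeft_ι, Sum.inr.injEq]
    by_cases h : j = i
    · subst h; simp; rfl
    · simp [h, Ne.symm h]

theorem modelPd_res {V' : Opens (Fin n → ℝ)} (h : V' ≤ V) (i : Idx n m) (f : Model m V) :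
    modelRes m h (modelPd V i f) = modelPd V' i (modelRes m h f) := by
  induction f using TensorProduct.induction_on with
  | zero => simp
  | add x y hx hy => simp only [map_add, hx, hy]
  | tmul a w =>
    rcases i with i | j
    · simp only [modelPd, modelRes, LinearMap.rTensor_tmul, Algebra.TensorProduct.map_tmul,
        Derivation.coeFn_coe]
      congr 1
      ext x
      change fderiv ℝ (extZero V a.1) x.1 _ = fderiv ℝ (extZero V' _) x.1 _
      rw [fderiv_extZero (V := V') (g := extZero V a.1)]
      exact fun y => (extZero_apply V a.1 ⟨y.1, h y.2⟩).symm
    · rfl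

theorem modelRes_coord {V' : Opens (Fin n → ℝ)} (h : V' ≤ V) (i : Idx n m) :
    modelRes m h (modelCoord V i) = modelCoord V' i := by
  rcases i with i | j <;> rfl

/-- On the exterior algebra this is induction over products of odd generators. On a smooth function
it is checked at each point `x` with the Hadamard decomposition: in `D(h k)` each term has a factor
vanishing at `x`, and in `D((x^i - c) g)` the derivative of the first factor is zero while the
factor itself vanishes at `x`. -/
theorem IsSuperDer.eq_zero_of_modelCoord {p : ZMod 2} {D : Model m V →ₗ[ℝ] Model m V}
    (hD : IsSuperDer (A := Model m V) (modelGr m V) p D)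
    (h : ∀ i, D (modelCoord V i) = 0) : D = 0 := by
  have h1 : D 1 = 0 := hD.map_one one_mem_modelGr
  have hw : ∀ w : ExteriorAlgebra ℝ (Fin m → ℝ), D ((1 : smoothFun V) ⊗ₜ w) = 0 := by
    intro w
    have hι : ∀ v : Fin m → ℝ, D ((1 : smoothFun V) ⊗ₜ ExteriorAlgebra.ι ℝ v) = 0 := fun v => by
      have : v = ∑ j, v j • Pi.single j (1 : ℝ) := by
        ext k; simp [Finset.sum_apply, Pi.single_apply]
      rw [this, map_sum, TensorProduct.tmul_sum, map_sum]
      refine Finset.sum_eq_zero fun j _ => ?_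
      rw [map_smul, TensorProduct.tmul_smul, map_smul]
      exact (congrArg _ (h (Sum.inr j))).trans (smul_zero _)
    induction w using CliffordAlgebra.left_induction with
    | algebraMap r =>
      rw [Algebra.algebraMap_eq_smul_one, TensorProduct.tmul_smul, map_smul]
      exact (congrArg _ h1).trans (smul_zero _)
    | add x y hx hy => rw [TensorProduct.tmul_add, map_add, hx, hy, add_zero]
    | ι_mul x v hx =>
      have := hD.2 1 ((1 : smoothFun V) ⊗ₜ ExteriorAlgebra.ι ℝ v)
        (tmul_mem_modelGr _ (CliffordAlgebra.ι_mem_evenOdd_one 0 _)) (1 ⊗ₜ x)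
      rw [hι, hx, Algebra.TensorProduct.tmul_mul_tmul, mul_one, zero_mul, mul_zero, smul_zero,
        add_zero] at this
      exact this
  have he : ∀ a : smoothFun V, a ⊗ₜ (1 : ExteriorAlgebra ℝ (Fin m → ℝ)) ∈ modelGr m V 0 :=
    fun a => tmul_mem_modelGr _ (CliffordAlgebra.one_le_evenOdd_zero 0 (by simp))
  have hl : ∀ (a : smoothFun V) (g : Model m V),
      D (a ⊗ₜ 1 * g) = D (a ⊗ₜ 1) * g + a ⊗ₜ 1 * D g := fun a g => by
    simpa [sgn] using hD.2 0 _ (he a) g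
  have ha : ∀ a : smoothFun V, D (a ⊗ₜ 1) = 0 := by
    intro a
    apply model_eq_zero_of_eval
    intro x
    obtain ⟨g, k, l, hk, hl', hf⟩ := exists_smoothFun_decomposition a x
    have hc : ∀ r : ℝ, D (algebraMap ℝ (smoothFun V) r ⊗ₜ 1) = 0 := fun r => by
      rw [Algebra.algebraMap_eq_smul_one, ← TensorProduct.smul_tmul', map_smul]
      exact (congrArg _ h1).trans (smul_zero _)
    have hmul : ∀ b c : smoothFun V, (b * c) ⊗ₜ[ℝ] (1 : ExteriorAlgebra ℝ (Fin m → ℝ)) =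
        b ⊗ₜ 1 * c ⊗ₜ 1 := fun b c => by
      rw [Algebra.TensorProduct.tmul_mul_tmul, one_mul]
    rw [hf, TensorProduct.add_tmul, TensorProduct.add_tmul, TensorProduct.sum_tmul,
      map_add D, map_add D, map_sum D, hc, zero_add, hmul k l, hl k, map_add, map_add, map_mul,
      map_mul]
    have hD1 : modelEval m x (D (k ⊗ₜ 1)) * modelEval m x (l ⊗ₜ 1) = 0 := by
      rw [modelEval_tmul, hl', zero_smul, mul_zero]
    have hD2 : modelEval m x (k ⊗ₜ 1) * modelEval m x (D (l ⊗ₜ 1)) = 0 := by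
      rw [modelEval_tmul, hk, zero_smul, zero_mul]
    rw [hD1, hD2, add_zero, add_zero, map_sum]
    refine Finset.sum_eq_zero fun i _ => ?_
    have hi : D ((smoothCoord V i - algebraMap ℝ _ (x.1 i)) ⊗ₜ 1) = 0 := by
      have := congrArg D (TensorProduct.add_tmul (R := ℝ)
        (smoothCoord V i - algebraMap ℝ _ (x.1 i)) (algebraMap ℝ (smoothFun V) (x.1 i))
        (1 : ExteriorAlgebra ℝ (Fin m → ℝ)))
      rw [sub_add_cancel, map_add D, hc, add_zero] at this
      exact this.symm.trans (h (Sum.inl i))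
    rw [hmul, hl, hi, zero_mul, zero_add, map_mul, modelEval_tmul,
      show (smoothCoord V i - algebraMap ℝ _ (x.1 i)).1 x = 0 from sub_self (x.1 i), zero_smul,
      zero_mul]
  ext1
  ext a w
  have : a ⊗ₜ[ℝ] w = a ⊗ₜ 1 * (1 : smoothFun V) ⊗ₜ w := by
    rw [Algebra.TensorProduct.tmul_mul_tmul, one_mul, mul_one]
  change D (a ⊗ₜ w) = 0
  rw [this, hl, ha, hw, zero_mul, mul_zero, add_zero]

end ModelDer

variable {M : Type u} [TopologicalSpace M] {X : SuperSpace.{u, v} M} {n m : ℕ}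

/-! ### Signs and homogeneous sections -/

theorem sgn_add (p q : ZMod 2) : sgn (p + q) = sgn p * sgn q := by
  rcases zmod2_cases p with rfl | rfl <;> rcases zmod2_cases q with rfl | rfl <;>
    simp [sgn, show (1 + 1 : ZMod 2) = 0 by decide]

theorem sgn_zero : sgn 0 = 1 := by simp [sgn]

theorem sgn_mul_self (p : ZMod 2) : sgn p * sgn p = 1 := by
  rcases zmod2_cases p with rfl | rfl <;> simp [sgn]

theorem smul_mem_gr {W : Opens M} {p : ZMod 2} (r : ℝ) {f : X.Sec W} (hf : f ∈ X.gr W p) :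
    r • f ∈ X.gr W p := Submodule.smul_mem _ r hf

theorem mul_mem_gr {W : Opens M} {p q : ZMod 2} {f g : X.Sec W} (hf : f ∈ X.gr W p)
    (hg : g ∈ X.gr W q) : f * g ∈ X.gr W (p + q) := SetLike.mul_mem_graded hf hg

theorem one_mem_gr {W : Opens M} : (1 : X.Sec W) ∈ X.gr W 0 := SetLike.one_mem_graded _

theorem sec_induction {W : Opens M} {P : X.Sec W → Prop} (f : X.Sec W)
    (hom : ∀ q, ∀ f ∈ X.gr W q, P f) (add : ∀ f g, P f → P g → P (f + g)) : P f := by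
  induction f using DirectSum.Decomposition.inductionOn (X.gr W) with
  | zero => exact hom 0 0 (zero_mem _)
  | homogeneous f => exact hom _ f.1 f.2
  | add f g hf hg => exact add f g hf hg

theorem eq_zero_of_add_eq_zero {W : Opens M} {f g : X.Sec W} {p q : ZMod 2} (hpq : p ≠ q)
    (hf : f ∈ X.gr W p) (hg : g ∈ X.gr W q) (h : f + g = 0) : f = 0 ∧ g = 0 := by
  have hd : f ∈ X.gr W q := by
    rw [eq_neg_of_add_eq_zero_left h]; exact neg_mem hg
  have hf0 : f = 0 := by
    rw [← DirectSum.decompose_of_mem_same (X.gr W) hf,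
      DirectSum.decompose_of_mem_ne (X.gr W) hd hpq.symm]
  exact ⟨hf0, by rw [hf0, zero_add] at h; exact h⟩

theorem IsSuperDer.map_const {W : Opens M} {p : ZMod 2} {D : X.Sec W →ₗ[ℝ] X.Sec W}
    (hD : IsSuperDer (X.gr W) p D) : D 1 = 0 := hD.map_one one_mem_gr

/-! ### Coordinates and derivations -/

theorem IsSuperDer.eq_zero_of_coord (φ : Chart X n m) {W : Opens M} (hW : W ≤ φ.dom) {p : ZMod 2}
    {D : X.Sec W →ₗ[ℝ] X.Sec W} (hD : IsSuperDer (X.gr W) p D)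
    (h : ∀ i, D (φ.coord hW i) = 0) : D = 0 := by
  let D' : Model m (imageOpens φ.homeo W) →ₗ[ℝ] Model m (imageOpens φ.homeo W) :=
    (φ.iso W hW).toLinearMap ∘ₗ D ∘ₗ (φ.iso W hW).symm.toLinearMap
  have hD' : IsSuperDer (A := Model m (imageOpens φ.homeo W)) (modelGr m _) p D' := by
    have hmem : ∀ q f, f ∈ modelGr m (imageOpens φ.homeo W) q →
        (φ.iso W hW).symm f ∈ X.gr W q := fun q f hf => by
      rw [← φ.iso_mem W hW]; simpa using hf
    refine ⟨fun q f hf => ?_, fun q f hf g => ?_⟩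
    · exact (φ.iso_mem W hW _ _).2 (hD.1 q _ (hmem q f hf))
    · have := congrArg (φ.iso W hW) (hD.2 q _ (hmem q f hf) ((φ.iso W hW).symm g))
      simpa [D'] using this
  have := hD'.eq_zero_of_modelCoord fun i => by
    change φ.iso W hW (D (φ.coord hW i)) = 0
    rw [h, map_zero]
  ext f
  have h2 : φ.iso W hW (D ((φ.iso W hW).symm (φ.iso W hW f))) = 0 :=
    LinearMap.congr_fun this (φ.iso W hW f)
  rw [AlgEquiv.symm_apply_apply] at h2
  exact (φ.iso W hW).injective (h2.trans (map_zero _).symm)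

namespace Chart

variable (φ ψ : Chart X n m) {W : Opens M} (hW : W ≤ φ.dom) (hψ : W ≤ ψ.dom)

theorem coord_mem (i : Idx n m) : φ.coord hW i ∈ X.gr W (par i) := by
  rw [← φ.iso_mem W hW, coord, AlgEquiv.apply_symm_apply]
  exact modelCoord_mem i

theorem pd_hasParity (i : Idx n m) : Der.HasParity (par i) (φ.pd hW i) :=
  φ.pdLin_isSuperDer hW i

theorem pd_mem (i : Idx n m) {q : ZMod 2} {f : X.Sec W} (hf : f ∈ X.gr W q) :
    (φ.pd hW i).1 f ∈ X.gr W (par i + q) := (φ.pd_hasParity hW i).1 q f hf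

theorem pd_mul (i : Idx n m) {q : ZMod 2} {f : X.Sec W} (hf : f ∈ X.gr W q) (g : X.Sec W) :
    (φ.pd hW i).1 (f * g) = (φ.pd hW i).1 f * g + sgn (par i * q) • (f * (φ.pd hW i).1 g) :=
  (φ.pd_hasParity hW i).2 q f hf g

theorem pd_coord (i j : Idx n m) :
    (φ.pd hW i).1 (φ.coord hW j) = if j = i then 1 else 0 := by
  change (φ.iso W hW).symm (modelPd _ i (φ.iso W hW ((φ.iso W hW).symm (modelCoord _ j)))) = _
  rw [AlgEquiv.apply_symm_apply, modelPd_coord]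
  split_ifs <;> simp

theorem pd_pd_coord (i j k : Idx n m) :
    (φ.pd hW i).1 ((φ.pd hW j).1 (φ.coord hW k)) = 0 := by
  rw [pd_coord]
  split_ifs
  · exact (φ.pdLin_isSuperDer hW i).map_const
  · exact map_zero _

theorem res_coord {W' : Opens M} (h : W' ≤ W) (i : Idx n m) :
    X.res h (φ.coord hW i) = φ.coord (h.trans hW) i := by
  apply (φ.iso W' (h.trans hW)).injective
  rw [φ.iso_res hW h, coord, coord, AlgEquiv.apply_symm_apply, AlgEquiv.apply_symm_apply]
  exact modelRes_coord _ i

theorem res_pd {W' : Opens M} (h : W' ≤ W) (i : Idx n m) :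
    Der.Restricts h (φ.pd hW i) (φ.pd (h.trans hW) i) := fun f => by
  apply (φ.iso W' (h.trans hW)).injective
  change φ.iso W' (h.trans hW) (X.res h ((φ.iso W hW).symm (modelPd _ i (φ.iso W hW f)))) =
    φ.iso W' (h.trans hW) ((φ.iso W' (h.trans hW)).symm (modelPd _ i
      (φ.iso W' (h.trans hW) (X.res h f))))
  rw [φ.iso_res hW h, φ.iso_res hW h, AlgEquiv.apply_symm_apply, AlgEquiv.apply_symm_apply]
  exact modelPd_res _ i _

/-- Two vector fields that agree on the coordinates are equal. -/
theorem der_ext {D E : Der X W} (h : ∀ i, D.1 (φ.coord hW i) = E.1 (φ.coord hW i)) : D = E := by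
  -- On a homogeneous coordinate the even and the odd part of `D - E` take values of opposite
  -- parities, so both values vanish when their sum does.
  obtain ⟨D₀, D₁, h₀, h₁, e⟩ := (D - E).2
  have hc : ∀ i, (D - E).1 (φ.coord hW i) = 0 := fun i => sub_eq_zero.2 (h i)
  have h01 : ∀ i, D₀ (φ.coord hW i) = 0 ∧ D₁ (φ.coord hW i) = 0 := fun i => by
    have := hc i
    rw [e] at this
    refine eq_zero_of_add_eq_zero ?_ (h₀.1 _ _ (φ.coord_mem hW i))
      (h₁.1 _ _ (φ.coord_mem hW i)) this
    simp
  have e0 := h₀.eq_zero_of_coord φ hW fun i => (h01 i).1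
  have e1 := h₁.eq_zero_of_coord φ hW fun i => (h01 i).2
  rw [e0, e1, add_zero] at e
  exact sub_eq_zero.1 (Subtype.ext e)

theorem sum_smul_apply {ι : Type*} (s : Finset ι) (a : ι → X.Sec W) (D : ι → Der X W)
    (f : X.Sec W) : (∑ i ∈ s, a i • D i).1 f = ∑ i ∈ s, a i * (D i).1 f := by
  rw [AddSubmonoidClass.coe_finsetSum, LinearMap.sum_apply]
  rfl

theorem der_eq_sum (D : Der X W) : D = ∑ i, D.1 (φ.coord hW i) • φ.pd hW i := by
  apply φ.der_ext hW
  intro j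
  rw [sum_smul_apply]
  simp [pd_coord]

theorem der_apply (D : Der X W) (f : X.Sec W) :
    D.1 f = ∑ i, D.1 (φ.coord hW i) * (φ.pd hW i).1 f := by
  conv_lhs => rw [φ.der_eq_sum hW D, sum_smul_apply]

/-- The Jacobian matrix `J_i^a = ∂y^a/∂x^i`. -/
def jac (i a : Idx n m) : X.Sec W := (φ.pd hW i).1 (ψ.coord hψ a)

theorem jac_mem (i a : Idx n m) : φ.jac ψ hW hψ i a ∈ X.gr W (par i + par a) :=
  φ.pd_mem hW i (ψ.coord_mem hψ a)

theorem pd_eq_sum (i : Idx n m) : φ.pd hW i = ∑ a, φ.jac ψ hW hψ i a • ψ.pd hψ a :=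
  ψ.der_eq_sum hψ _

theorem pd_apply (i : Idx n m) (f : X.Sec W) :
    (φ.pd hW i).1 f = ∑ a, φ.jac ψ hW hψ i a * (ψ.pd hψ a).1 f :=
  ψ.der_apply hψ _ f

/-- The chain rule for `∂_i` applied to the coordinate `x^k` itself. -/
theorem sum_jac_mul_jac (i k : Idx n m) :
    ∑ a, φ.jac ψ hW hψ i a * ψ.jac φ hψ hW a k = if k = i then 1 else 0 := by
  rw [← φ.pd_coord hW i k, φ.pd_apply ψ hW hψ]
  rfl

end Chart

/-! ### One-forms -/

namespace OneForm

variable {U : Opens M}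

instance : Zero (OneForm X U) := ⟨⟨fun _ _ => 0, fun _ _ _ _ _ => map_zero _⟩⟩

theorem ext_apply {ω η : OneForm X U} (h : ∀ W hW D, ω.app W hW D = η.app W hW D) : ω = η := by
  ext W hW D
  exact h W hW D

instance : AddCommMonoid (OneForm X U) where
  add_assoc _ _ _ := ext_apply fun _ _ _ => add_assoc _ _ _
  zero_add _ := ext_apply fun _ _ _ => zero_add _
  add_zero _ := ext_apply fun _ _ _ => add_zero _
  add_comm _ _ := ext_apply fun _ _ _ => add_comm _ _
  nsmul := nsmulRec

theorem add_app (ω η : OneForm X U) {W : Opens M} (hW : W ≤ U) (D : Der X W) :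
    (ω + η).app W hW D = ω.app W hW D + η.app W hW D := rfl

theorem sum_app {ι : Type*} (s : Finset ι) (ω : ι → OneForm X U) {W : Opens M} (hW : W ≤ U)
    (D : Der X W) : (∑ i ∈ s, ω i).app W hW D = ∑ i ∈ s, (ω i).app W hW D :=
  map_sum (⟨⟨fun ω : OneForm X U => ω.app W hW D, rfl⟩, fun _ _ => rfl⟩ :
    OneForm X U →+ X.Sec W) ω s

theorem mulRight_app (ω : OneForm X U) (f : X.Sec U) {W : Opens M} (hW : W ≤ U) (D : Der X W) :
    (ω.mulRight f).app W hW D = ω.app W hW D * X.res hW f := rfl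

theorem d_app (f : X.Sec U) {W : Opens M} (hW : W ≤ U) (D : Der X W) :
    (d f).app W hW D = D.1 (X.res hW f) := rfl

theorem d_app_self (f : X.Sec U) (D : Der X U) : (d f).app U le_rfl D = D.1 f := by
  rw [d_app, X.res_self]

theorem mulRight_app_self (ω : OneForm X U) (f : X.Sec U) (D : Der X U) :
    (ω.mulRight f).app U le_rfl D = ω.app U le_rfl D * f := by
  rw [mulRight_app, X.res_self]

theorem mulRight_add (ω : OneForm X U) (f g : X.Sec U) :
    ω.mulRight (f + g) = ω.mulRight f + ω.mulRight g :=
  ext_apply fun W hW D => by rw [add_app, mulRight_app, mulRight_app, mulRight_app, map_add,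
    mul_add]

theorem d_add (f g : X.Sec U) : d (f + g) = d f + d g :=
  ext_apply fun W hW D => by rw [add_app, d_app, d_app, d_app, map_add, map_add]

theorem restrict_d {V : Opens M} (h : V ≤ U) (f : X.Sec U) :
    (d f).restrict h = d (X.res h f) :=
  ext_apply fun W hW D => by
    change D.1 (X.res (hW.trans h) f) = D.1 (X.res hW (X.res h f))
    rw [X.res_res]

theorem restrict_mulRight {V : Opens M} (h : V ≤ U) (ω : OneForm X U) (f : X.Sec U) :
    (ω.mulRight f).restrict h = (ω.restrict h).mulRight (X.res h f) :=
  ext_apply fun W hW D => by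
    change ω.app W _ D * X.res (hW.trans h) f = ω.app W _ D * X.res hW (X.res h f)
    rw [X.res_res]

theorem hasParity_d {q : ZMod 2} {f : X.Sec U} (hf : f ∈ X.gr U q) : (d f).HasParity q :=
  fun _ hW _ _ hD => hD.1 q _ (X.res_mem hW q f hf)

theorem HasParity.mulRight {q a : ZMod 2} {ω : OneForm X U} (hω : ω.HasParity q) {f : X.Sec U}
    (hf : f ∈ X.gr U a) : (ω.mulRight f).HasParity (q + a) := fun W hW p D hD => by
  rw [mulRight_app, ← add_assoc]
  exact mul_mem_gr (hω W hW p D hD) (X.res_mem hW a f hf)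

theorem HasParity.sum {ι : Type*} {s : Finset ι} {q : ZMod 2} {ω : ι → OneForm X U}
    (hω : ∀ i ∈ s, (ω i).HasParity q) : (∑ i ∈ s, ω i).HasParity q := fun W hW p D hD => by
  rw [sum_app]
  exact sum_mem fun i hi => hω i hi W hW p D hD

theorem HasParity.restrict {V : Opens M} (h : V ≤ U) {q : ZMod 2} {ω : OneForm X U}
    (hω : ω.HasParity q) : (ω.restrict h).HasParity q := fun W hW p D hD =>
  hω W (hW.trans h) p D hD

end OneForm

namespace Chart

variable (φ ψ : Chart X n m) {W : Opens M} (hW : W ≤ φ.dom) (hψ : W ≤ ψ.dom)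

/-- The coordinate fields generate the vector fields on every smaller open set and are restrictions
of those on `W`, so naturality brings everything back to `W`. -/
theorem oneForm_ext {ω η : OneForm X W}
    (h : ∀ i, ω.app W le_rfl (φ.pd hW i) = η.app W le_rfl (φ.pd hW i)) : ω = η := by
  refine OneForm.ext_apply fun W' hW' D => ?_
  rw [φ.der_eq_sum (hW'.trans hW) D, map_sum, map_sum]
  refine Finset.sum_congr rfl fun i _ => ?_
  rw [map_smul, map_smul, ← ω.natural le_rfl hW' _ _ (φ.res_pd hW hW' i),
    ← η.natural le_rfl hW' _ _ (φ.res_pd hW hW' i), h]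

theorem oneForm_eq_sum (ω : OneForm X W) :
    ω = ∑ i, (OneForm.d (φ.coord hW i)).mulRight (ω.app W le_rfl (φ.pd hW i)) := by
  refine φ.oneForm_ext hW fun j => ?_
  rw [OneForm.sum_app]
  simp [OneForm.mulRight_app_self, OneForm.d_app_self, pd_coord]

end Chart

/-! ### Tensors -/

namespace SymTensor

variable {ε : ZMod 2} (S : SymTensor X ε) {U : Opens M}

/-- The additive map `S(ω, ·)`. -/
def right (ω : OneForm X U) : OneForm X U →+ X.Sec U :=
  AddMonoidHom.mk' (S.app U ω) (S.add_right U ω)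

variable (φ : Chart X n m) {W : Opens M} (hW : W ≤ φ.dom)

theorem app_eq_sum (ω η : OneForm X W) :
    S.app W ω η = ∑ j, S.app W ω (OneForm.d (φ.coord hW j)) * η.app W le_rfl (φ.pd hW j) := by
  conv_lhs => rw [φ.oneForm_eq_sum hW η]
  refine (map_sum (S.right ω) _ _).trans (Finset.sum_congr rfl fun j _ => ?_)
  exact S.mul_right W _ _ _

theorem app_d (ω : OneForm X W) (f : X.Sec W) :
    S.app W ω (OneForm.d f) =
      ∑ j, S.app W ω (OneForm.d (φ.coord hW j)) * (φ.pd hW j).1 f := by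
  simp_rw [S.app_eq_sum φ hW ω (OneForm.d f), OneForm.d_app_self]

theorem symm_d {p q : ZMod 2} {f g : X.Sec U} (hf : f ∈ X.gr U p) (hg : g ∈ X.gr U q) :
    S.app U (OneForm.d f) (OneForm.d g) = sgn (p * q) • S.app U (OneForm.d g) (OneForm.d f) :=
  S.symm U p q _ _ (OneForm.hasParity_d hf) (OneForm.hasParity_d hg)

theorem app_d_mem {p q : ZMod 2} {f g : X.Sec U} (hf : f ∈ X.gr U p) (hg : g ∈ X.gr U q) :
    S.app U (OneForm.d f) (OneForm.d g) ∈ X.gr U (ε + p + q) :=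
  S.parity U p q _ _ (OneForm.hasParity_d hf) (OneForm.hasParity_d hg)

end SymTensor

theorem sgn_smul_congr {A : Type*} [SMul ℝ A] {p q : ZMod 2} {x y : A} (h : p = q) (hx : x = y) :
    sgn p • x = sgn q • y := by rw [h, hx]

/-! ### The Hessian of a function -/

section Hess

variable {W : Opens M} (C : SymConnection X)

/-- The Hessian `D (E f) - (∇_D E) f`. -/
def hess (D E : Der X W) (f : X.Sec W) : X.Sec W := D.1 (E.1 f) - (C.cov W D E).1 f

theorem hess_sum_left {ι : Type*} (s : Finset ι) (a : ι → X.Sec W) (D : ι → Der X W)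
    (E : Der X W) (f : X.Sec W) :
    hess C (∑ i ∈ s, a i • D i) E f = ∑ i ∈ s, a i * hess C (D i) E f := by
  refine (map_sum (AddMonoidHom.mk' (fun D => hess C D E f) fun D D' => ?_) _ s).trans
    (Finset.sum_congr rfl fun i _ => ?_)
  · simp only [hess, C.add_left, Submodule.coe_add, LinearMap.add_apply]; abel
  · change hess C (a i • D i) E f = _
    simp only [hess, C.smul_left, Submodule.coe_smul, LinearMap.smul_apply, smul_eq_mul, mul_sub]

/-- The terms `D(a_i) E_i f` produced by differentiating `E f` and by the Leibniz rule of the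
connection cancel. This makes the Hessian tensorial in its second argument, up to the sign of moving
`D` past `a_i`. -/
theorem hess_sum_right {ι : Type*} (s : Finset ι) (a : ι → X.Sec W) (q : ι → ZMod 2)
    (ha : ∀ i, a i ∈ X.gr W (q i)) {p : ZMod 2} {D : Der X W} (hD : Der.HasParity p D)
    (E : ι → Der X W) (f : X.Sec W) :
    hess C D (∑ i ∈ s, a i • E i) f = ∑ i ∈ s, sgn (p * q i) • (a i * hess C D (E i) f) := by
  refine (map_sum (AddMonoidHom.mk' (fun E => hess C D E f) fun E E' => ?_) _ s).trans
    (Finset.sum_congr rfl fun i _ => ?_)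
  · simp only [hess, C.add_right, Submodule.coe_add, LinearMap.add_apply, map_add]; abel
  · change hess C D (a i • E i) f = _
    simp only [hess, C.leibniz W p (q i) D (a i) (E i) hD (ha i), Submodule.coe_smul,
      Submodule.coe_add, LinearMap.add_apply, LinearMap.smul_apply, smul_eq_mul, mul_sub,
      hD.2 (q i) (a i) (ha i), smul_sub]
    change _ - (_ + sgn (p * q i) • (a i * _)) = _
    abel

variable {ε : ZMod 2} (S : SymTensor X ε)

/-- The contraction `S^{ij} ∇_j ∂_i f` of a tensor with the Hessian. -/
def Chart.hessTrace (φ : Chart X n m) (hW : W ≤ φ.dom) (f : X.Sec W) : X.Sec W :=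
  ∑ i, ∑ j, φ.tensorCoeff hW S i j * hess C (φ.pd hW j) (φ.pd hW i) f

/-- The Jacobian factors that expand the coordinate fields are absorbed by `S`, one index at a time:
first the index `j`, then `i`. -/
theorem Chart.hessTrace_eq (φ ψ : Chart X n m) (hφ : W ≤ φ.dom) (hψ : W ≤ ψ.dom) (f : X.Sec W) :
    φ.hessTrace C S hφ f = ψ.hessTrace C S hψ f := by
  have h1 : ∀ i, ∑ j, φ.tensorCoeff hφ S i j * hess C (φ.pd hφ j) (φ.pd hφ i) f =
      ∑ b, S.app W (OneForm.d (φ.coord hφ i)) (OneForm.d (ψ.coord hψ b)) *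
        hess C (ψ.pd hψ b) (φ.pd hφ i) f := fun i => by
    simp_rw [S.app_d φ hφ (OneForm.d (φ.coord hφ i)) (ψ.coord hψ _), Finset.sum_mul]
    rw [Finset.sum_comm]
    refine Finset.sum_congr rfl fun j _ => ?_
    rw [φ.pd_eq_sum ψ hφ hψ j, hess_sum_left, Finset.mul_sum]
    refine Finset.sum_congr rfl fun b _ => ?_
    rw [← mul_assoc, ← φ.pd_eq_sum ψ hφ hψ j]
    rfl
  have h2 : ∀ b, ∑ i, S.app W (OneForm.d (φ.coord hφ i)) (OneForm.d (ψ.coord hψ b)) *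
        hess C (ψ.pd hψ b) (φ.pd hφ i) f =
      ∑ a, ψ.tensorCoeff hψ S a b * hess C (ψ.pd hψ b) (ψ.pd hψ a) f := fun b => by
    -- `S` is right linear in its second slot, so the first index is transformed by exchanging the
    -- slots before and after, at the cost of signs.
    have e : ∀ a, ψ.tensorCoeff hψ S a b = sgn (par a * par b) • ∑ i,
        S.app W (OneForm.d (ψ.coord hψ b)) (OneForm.d (φ.coord hφ i)) * φ.jac ψ hφ hψ i a :=
      fun a => by
        rw [Chart.tensorCoeff, S.symm_d (ψ.coord_mem hψ a) (ψ.coord_mem hψ b),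
          S.app_d φ hφ _ (ψ.coord hψ a)]
        rfl
    simp_rw [e, smul_mul_assoc, Finset.sum_mul, Finset.smul_sum]
    rw [Finset.sum_comm]
    refine Finset.sum_congr rfl fun i _ => ?_
    rw [φ.pd_eq_sum ψ hφ hψ i, hess_sum_right C _ _ (fun a => par i + par a)
      (fun a => φ.jac_mem ψ hφ hψ i a) (ψ.pd_hasParity hψ b), Finset.mul_sum]
    refine Finset.sum_congr rfl fun a _ => ?_
    rw [S.symm_d (φ.coord_mem hφ i) (ψ.coord_mem hψ b), smul_mul_assoc, mul_smul_comm, smul_smul,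
      ← sgn_add, mul_assoc]
    refine sgn_smul_congr ?_ rfl
    generalize par i = i, par a = a, par b = b
    revert i a b; decide
  unfold Chart.hessTrace
  simp_rw [h1]
  rw [Finset.sum_comm]
  simp_rw [h2]
  rw [Finset.sum_comm]

end Hess

/-! ### Supertraces and divergences -/

theorem Der.HasParity.sum {ι : Type*} {s : Finset ι} {W : Opens M} {p : ZMod 2}
    {D : ι → Der X W} (h : ∀ i ∈ s, Der.HasParity p (D i)) : Der.HasParity p (∑ i ∈ s, D i) := by
  classical
  induction s using Finset.induction_on with
  | empty => exact IsSuperDer.zero W p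
  | insert i s hi ih =>
    rw [Finset.sum_insert hi]
    exact IsSuperDer.add (h i (Finset.mem_insert_self i s))
      (ih fun j hj => h j (Finset.mem_insert_of_mem hj))

theorem Der.HasParity.smul {W : Opens M} {a p : ZMod 2} {f : X.Sec W} (hf : f ∈ X.gr W a)
    {D : Der X W} (hD : Der.HasParity p D) : Der.HasParity (a + p) (f • D) :=
  IsSuperDer.smul hf hD

namespace Chart

variable (φ ψ : Chart X n m) {W : Opens M} (hφ : W ≤ φ.dom) (hψ : W ≤ ψ.dom)

/-- The supertrace of a left linear operator of parity `p` on vector fields. -/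
def superTrace (p : ZMod 2) (T : Der X W →ₗ[X.Sec W] Der X W) : X.Sec W :=
  ∑ i, sgn (par i * (1 + p)) • (T (φ.pd hφ i)).1 (φ.coord hφ i)

/-- Moving the inverse Jacobian from the last place to the first turns the weight `(-1)^{i(1+p)}`
into `(-1)^{b(1+p)}`, which no longer depends on the summation index `i`; the two Jacobians then
contract to the identity. -/
theorem superTrace_eq {p : ZMod 2} {T : Der X W →ₗ[X.Sec W] Der X W}
    (hT : ∀ q D, Der.HasParity q D → Der.HasParity (q + p) (T D)) :
    φ.superTrace hφ p T = ψ.superTrace hψ p T := by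
  have hm : ∀ a b, (T (ψ.pd hψ a)).1 (ψ.coord hψ b) ∈ X.gr W (par a + p + par b) := fun a b =>
    (hT _ _ (ψ.pd_hasParity hψ a)).1 _ _ (ψ.coord_mem hψ b)
  have h1 : ∀ i, sgn (par i * (1 + p)) • (T (φ.pd hφ i)).1 (φ.coord hφ i) =
      ∑ a, ∑ b, sgn (par b * (1 + p)) • (ψ.jac φ hψ hφ b i * φ.jac ψ hφ hψ i a *
        (T (ψ.pd hψ a)).1 (ψ.coord hψ b)) := fun i => by
    rw [φ.pd_eq_sum ψ hφ hψ i, map_sum]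
    simp_rw [map_smul]
    rw [sum_smul_apply, Finset.smul_sum]
    refine Finset.sum_congr rfl fun a _ => ?_
    rw [ψ.der_apply hψ, Finset.mul_sum, Finset.smul_sum]
    refine Finset.sum_congr rfl fun b _ => ?_
    change sgn _ • (_ * (_ * ψ.jac φ hψ hφ b i)) = _
    rw [← mul_assoc, X.supercomm W _ _ _ (mul_mem_gr (φ.jac_mem ψ hφ hψ i a) (hm a b)) _
      (ψ.jac_mem φ hψ hφ b i), smul_smul, ← sgn_add, ← mul_assoc]
    refine sgn_smul_congr ?_ rfl
    generalize par i = i, par a = a, par b = b, p = r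
    revert i a b r; decide
  unfold superTrace
  simp_rw [h1]
  rw [Finset.sum_comm]
  refine Finset.sum_congr rfl fun a _ => ?_
  rw [Finset.sum_comm]
  simp_rw [← Finset.smul_sum, ← Finset.sum_mul, sum_jac_mul_jac]
  simp

end Chart

section Divergence

variable {W : Opens M} (C : SymConnection X)

/-- The left linear operator `D ↦ ∇_D E`. -/
def covLeft (E : Der X W) : Der X W →ₗ[X.Sec W] Der X W where
  toFun D := C.cov W D E
  map_add' D D' := C.add_left W D D' E
  map_smul' f D := C.smul_left W f D E

namespace Chart

variable (φ ψ : Chart X n m) (hφ : W ≤ φ.dom) (hψ : W ≤ ψ.dom)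

/-- The contraction `τ_i = Γ^s_{is} (-1)^s` of the coefficients of a connection. -/
def contraction (i : Idx n m) : X.Sec W := ∑ s, sgn (par s) • φ.christoffel hφ C i s s

theorem christoffel_mem (i j k : Idx n m) :
    φ.christoffel hφ C i j k ∈ X.gr W (par i + par j + par k) :=
  (C.parity W _ _ _ _ (φ.pd_hasParity hφ i) (φ.pd_hasParity hφ j)).1 _ _ (φ.coord_mem hφ k)

theorem contraction_mem (i : Idx n m) : φ.contraction C hφ i ∈ X.gr W (par i) := by
  refine sum_mem fun s _ => smul_mem_gr _ ?_
  have := φ.christoffel_mem C hφ i s s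
  rwa [add_assoc, CharTwo.add_self_eq_zero, add_zero] at this

theorem christoffel_symm (i j k : Idx n m) :
    φ.christoffel hφ C i j k = sgn (par i * par j) • φ.christoffel hφ C j i k := by
  have := C.torsion_free W _ _ _ _ (φ.pd_hasParity hφ i) (φ.pd_hasParity hφ j) (φ.coord hφ k)
  rw [pd_pd_coord, pd_pd_coord, smul_zero, sub_zero] at this
  exact sub_eq_zero.1 this

/-- The divergence formula. The supertrace contracts the direction of differentiation, giving
`Γ^i_{ik}`; torsion-freeness exchanges the lower indices and turns this into `τ_k`. -/
theorem superTrace_covLeft {p : ZMod 2} {E : Der X W} (hE : Der.HasParity p E) :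
    φ.superTrace hφ p (covLeft C E) =
      ∑ i, sgn (par i * (1 + p)) • (φ.pd hφ i).1 (E.1 (φ.coord hφ i)) +
        ∑ k, E.1 (φ.coord hφ k) * φ.contraction C hφ k := by
  have hm : ∀ k, E.1 (φ.coord hφ k) ∈ X.gr W (p + par k) := fun k =>
    hE.1 _ _ (φ.coord_mem hφ k)
  have h1 : ∀ i, (covLeft C E (φ.pd hφ i)).1 (φ.coord hφ i) =
      (φ.pd hφ i).1 (E.1 (φ.coord hφ i)) + ∑ k, sgn (par i * (p + par k)) •
        (E.1 (φ.coord hφ k) * φ.christoffel hφ C i k i) := fun i => by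
    -- Expand the Hessian of the coordinate `x^i` along `∂_i` and `E`. Second derivatives of
    -- coordinates vanish, so only the Christoffel terms remain on the expanded side.
    have := hess_sum_right C Finset.univ _ _ hm (φ.pd_hasParity hφ i) (φ.pd hφ) (φ.coord hφ i)
    rw [← φ.der_eq_sum hφ E] at this
    simp only [hess, pd_pd_coord, zero_sub, mul_neg, smul_neg, Finset.sum_neg_distrib] at this
    rw [sub_eq_iff_eq_add, eq_comm, neg_add_eq_iff_eq_add] at this
    exact this.trans (add_comm _ _)
  unfold superTrace contraction
  simp_rw [h1, smul_add, Finset.sum_add_distrib, Finset.smul_sum, Finset.mul_sum]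
  congr 1
  rw [Finset.sum_comm]
  refine Finset.sum_congr rfl fun k _ => Finset.sum_congr rfl fun i _ => ?_
  rw [φ.christoffel_symm C hφ i k i, mul_smul_comm, mul_smul_comm, smul_smul, smul_smul,
    ← sgn_add, ← sgn_add]
  refine sgn_smul_congr ?_ rfl
  generalize par i = i, par k = k, p = r
  revert i k r; decide

end Chart

end Divergence

/-! ### Jacobi's formula -/

section Jacobi

variable {R A : Type*} [CommRing R] [Ring A] {v : R →+* A} {d : R →+ A}

/-- In the application `R` consists of the even sections and `A` of all sections. An odd derivation
leaves the commutative ring `R`, so the Leibniz rule is stated along `v`, with the undifferentiated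
factors on the right; only products inside `R` are then commuted. -/
theorem map_prod_of_leibniz (hd : ∀ a b, d (a * b) = d a * v b + d b * v a) {ι : Type*}
    [DecidableEq ι] (s : Finset ι) (a : ι → R) :
    d (∏ i ∈ s, a i) = ∑ i ∈ s, d (a i) * v (∏ j ∈ s.erase i, a j) := by
  induction s using Finset.induction_on with
  | empty =>
    have := hd 1 1
    simp only [mul_one, map_one] at this
    simpa using this
  | insert i s hi ih =>
    rw [Finset.prod_insert hi, hd, Finset.sum_insert hi, Finset.erase_insert hi, ih,
      Finset.sum_mul]
    congr 1
    refine Finset.sum_congr rfl fun j hj => ?_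
    have hij : i ≠ j := fun h => hi (h ▸ hj)
    rw [mul_assoc, ← map_mul, Finset.erase_insert_of_ne hij,
      Finset.prod_insert (fun h => hi (Finset.mem_of_mem_erase h)), mul_comm (a i)]

/-- Differentiating the permutation expansion replaces one factor, that of a column `j`, by its
derivative. The remaining products, grouped by the row `σ j = i`, form the adjugate entry. -/
theorem map_det_of_leibniz (hd : ∀ a b, d (a * b) = d a * v b + d b * v a) {ι : Type*}
    [Fintype ι] [DecidableEq ι] (T : Matrix ι ι R) :
    d T.det = ∑ i, ∑ j, d (T i j) * v (T.adjugate j i) := by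
  have hadj : ∀ i j, T.adjugate j i = ∑ σ : Equiv.Perm ι,
      if σ j = i then (Equiv.Perm.sign σ : ℤ) • ∏ k ∈ Finset.univ.erase j, T (σ k) k else 0 := by
    intro i j
    rw [Matrix.adjugate_apply, Matrix.det_apply]
    refine Finset.sum_congr rfl fun σ _ => ?_
    split_ifs with h
    · rw [← Finset.mul_prod_erase _ _ (Finset.mem_univ j), h, Matrix.updateRow_self,
        Pi.single_eq_same, one_mul, Units.smul_def]
      congr 1
      refine Finset.prod_congr rfl fun k hk => ?_
      rw [Matrix.updateRow_ne]
      exact fun hk' => Finset.ne_of_mem_erase hk (σ.injective (hk'.trans h.symm))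
    · rw [Finset.prod_eq_zero (Finset.mem_univ (σ.symm i)), smul_zero]
      rw [Equiv.apply_symm_apply, Matrix.updateRow_self, Pi.single_eq_of_ne]
      exact fun h' => h (by rw [← h', Equiv.apply_symm_apply])
  have hcol : ∀ j (σ : Equiv.Perm ι), ∑ i, d (T i j) * v (if σ j = i then
      (Equiv.Perm.sign σ : ℤ) • ∏ k ∈ Finset.univ.erase j, T (σ k) k else 0) =
      (Equiv.Perm.sign σ : ℤ) •
        (d (T (σ j) j) * v (∏ k ∈ Finset.univ.erase j, T (σ k) k)) := by
    intro j σ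
    rw [Finset.sum_eq_single (σ j) (fun i _ hi => by simp [Ne.symm hi])
      (fun h => absurd (Finset.mem_univ _) h), if_pos rfl, map_zsmul, mul_smul_comm]
  have hcol' : ∀ j, ∑ i, d (T i j) * v (T.adjugate j i) = ∑ σ : Equiv.Perm ι,
      (Equiv.Perm.sign σ : ℤ) •
        (d (T (σ j) j) * v (∏ k ∈ Finset.univ.erase j, T (σ k) k)) := fun j => by
    simp_rw [hadj, map_sum, Finset.mul_sum]
    rw [Finset.sum_comm]
    exact Finset.sum_congr rfl fun σ _ => hcol j σ
  rw [Finset.sum_comm]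
  simp_rw [hcol']
  rw [Finset.sum_comm, Matrix.det_apply, map_sum]
  refine Finset.sum_congr rfl fun σ _ => ?_
  rw [Units.smul_def, map_zsmul, map_prod_of_leibniz hd, Finset.smul_sum]

theorem map_det_of_leibniz_of_mul_eq_one (hd : ∀ a b, d (a * b) = d a * v b + d b * v a)
    {ι : Type*} [Fintype ι] [DecidableEq ι] {T K : Matrix ι ι R} (h : T * K = 1) :
    d T.det = Matrix.trace (T.map d * K.map v) * v T.det := by
  -- The adjugate times `T * K = 1`, with the product of the adjugate and `T` evaluated first.
  have hK : T.adjugate = T.det • K := by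
    rw [← one_mul K, ← smul_mul_assoc, ← Matrix.adjugate_mul, Matrix.mul_assoc, h,
      Matrix.mul_one]
  rw [map_det_of_leibniz hd, hK]
  simp only [Matrix.trace, Matrix.diag_apply, Matrix.mul_apply, Matrix.map_apply,
    Matrix.smul_apply, smul_eq_mul, Finset.sum_mul, mul_assoc, ← map_mul, mul_comm]

end Jacobi

/-! ### The Berezinian and its logarithmic derivative -/

section Berezinian

variable {W : Opens M}

/-! ### Even elements -/

/-- The inclusion of the even sections. -/
def evenVal (X : SuperSpace.{u, v} M) (W : Opens M) : X.gr W 0 →+* X.Sec W where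
  toFun := Subtype.val
  map_one' := rfl
  map_mul' _ _ := rfl
  map_zero' := rfl
  map_add' _ _ := rfl

theorem evenPart_val {f : X.Sec W} (hf : f ∈ X.gr W 0) : (evenPart f).1 = f :=
  DirectSum.decompose_of_mem_same (X.gr W) hf

theorem mul_self_of_odd {f : X.Sec W} (hf : f ∈ X.gr W 1) : f * f = 0 := by
  have := X.supercomm W 1 1 f hf f hf
  have h2 : (2 : ℝ) • (f * f) = 0 := by
    rw [two_smul]; nth_rewrite 1 [this]; simp [sgn]
  exact (smul_eq_zero_iff_right two_ne_zero).1 h2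

theorem isNilpotent_evenPart_mul {f g : X.Sec W} (hf : f ∈ X.gr W 1) (hg : g ∈ X.gr W 1) :
    IsNilpotent (evenPart (f * g)) := by
  refine ⟨2, ?_⟩
  apply Subtype.ext
  have hfg : f * g ∈ X.gr W 0 := by
    have := mul_mem_gr hf hg
    rwa [show (1 + 1 : ZMod 2) = 0 by decide] at this
  rw [pow_two]
  change (evenPart (f * g)).1 * (evenPart (f * g)).1 = 0
  rw [evenPart_val hfg, mul_assoc, ← mul_assoc g, X.supercomm W 1 1 g hg f hf, smul_mul_assoc,
    mul_smul_comm, mul_assoc f g g, mul_self_of_odd hg, mul_zero, mul_zero, smul_zero]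

/-! ### Matrices with homogeneous entries -/

section Matrices

variable {ι κ l : Type*}

/-- All entries of the matrix have parity `q`. -/
def MatMem (q : ZMod 2) (T : Matrix ι κ (X.Sec W)) : Prop := ∀ i j, T i j ∈ X.gr W q

theorem MatMem.mul [Fintype κ] {q r : ZMod 2} {T : Matrix ι κ (X.Sec W)}
    {K : Matrix κ l (X.Sec W)} (hT : MatMem q T) (hK : MatMem r K) : MatMem (q + r) (T * K) :=
  fun i j => sum_mem fun k _ => mul_mem_gr (hT i k) (hK k j)

theorem MatMem.sub {q : ZMod 2} {T K : Matrix ι κ (X.Sec W)} (hT : MatMem q T)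
    (hK : MatMem q K) : MatMem q (T - K) := fun i j => sub_mem (hT i j) (hK i j)

theorem trace_mul_comm_of_matMem [Fintype ι] [Fintype κ] {q r : ZMod 2}
    {T : Matrix ι κ (X.Sec W)} {K : Matrix κ ι (X.Sec W)} (hT : MatMem q T) (hK : MatMem r K) :
    (T * K).trace = sgn (q * r) • (K * T).trace := by
  simp only [Matrix.trace, Matrix.diag_apply, Matrix.mul_apply, Finset.smul_sum]
  rw [Finset.sum_comm]
  exact Finset.sum_congr rfl fun j _ => Finset.sum_congr rfl fun i _ =>
    X.supercomm W q r _ (hT i j) _ (hK j i)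

theorem map_evenPart_map_val {T : Matrix ι κ (X.Sec W)} (hT : MatMem 0 T) :
    (T.map evenPart).map Subtype.val = T := by
  ext i j
  exact evenPart_val (hT i j)

theorem matMem_map_val (T : Matrix ι κ (X.gr W 0)) : MatMem 0 (T.map Subtype.val) :=
  fun i j => (T i j).2

theorem map_val_mul [Fintype κ] (T : Matrix ι κ (X.gr W 0)) (K : Matrix κ l (X.gr W 0)) :
    (T * K).map Subtype.val = T.map Subtype.val * K.map Subtype.val :=
  Matrix.map_mul (f := evenVal X W)

theorem map_val_one [DecidableEq ι] :
    (1 : Matrix ι ι (X.gr W 0)).map Subtype.val = (1 : Matrix ι ι (X.Sec W)) :=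
  Matrix.map_one (evenVal X W) (map_zero _) (map_one _)

theorem map_val_injective :
    Function.Injective (fun T : Matrix ι κ (X.gr W 0) => T.map Subtype.val) :=
  Matrix.map_injective Subtype.val_injective

variable {p : ZMod 2} {D : X.Sec W →ₗ[ℝ] X.Sec W}

theorem IsSuperDer.map_matrix_mul [Fintype κ] (hD : IsSuperDer (X.gr W) p D) {q : ZMod 2}
    {T : Matrix ι κ (X.Sec W)} (hT : MatMem q T) (K : Matrix κ l (X.Sec W)) :
    (T * K).map D = T.map D * K + sgn (p * q) • (T * K.map D) := by
  ext i j
  simp only [Matrix.map_apply, Matrix.mul_apply, Matrix.add_apply, Matrix.smul_apply, map_sum,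
    Finset.smul_sum, ← Finset.sum_add_distrib]
  exact Finset.sum_congr rfl fun k _ => hD.2 q _ (hT i k) _

theorem IsSuperDer.matMem_map (hD : IsSuperDer (X.gr W) p D) {q : ZMod 2}
    {T : Matrix ι κ (X.Sec W)} (hT : MatMem q T) : MatMem (p + q) (T.map D) :=
  fun i j => hD.1 q _ (hT i j)

theorem IsSuperDer.map_matrix_one [DecidableEq ι] (hD : IsSuperDer (X.gr W) p D) :
    (1 : Matrix ι ι (X.Sec W)).map D = 0 := by
  ext i j
  rw [Matrix.map_apply, Matrix.one_apply]
  split_ifs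
  · exact hD.map_const
  · exact map_zero _

theorem IsSuperDer.map_det [Fintype ι] [DecidableEq ι] (hD : IsSuperDer (X.gr W) p D)
    {T K : Matrix ι ι (X.gr W 0)} (h : T * K = 1) :
    D T.det.1 =
      ((T.map Subtype.val).map D * K.map Subtype.val).trace * T.det.1 :=
  map_det_of_leibniz_of_mul_eq_one (v := evenVal X W)
    (d := (D.toAddMonoidHom).comp (evenVal X W).toAddMonoidHom) (fun a b => by
      have := hD.2 0 a.1 a.2 b.1
      rw [mul_zero, sgn_zero, one_smul, even_comm a (D b.1)] at this
      exact this) h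

end Matrices

/-! ### The derivative of the Berezinian -/

/-- Entries of a product of two odd matrices are sums of products of odd elements, hence nilpotent.
Modulo the nilradical `e` is inverse to `d`, and an element that is a unit modulo nilpotents is a
unit. This ensures that the matrix inverse in the definition of the Berezinian is a true inverse. -/
theorem isUnit_det_of_mul_add_mul {ι κ : Type*} [Fintype ι] [DecidableEq ι] [Fintype κ]
    {d e : Matrix ι ι (X.Sec W)} {c : Matrix ι κ (X.Sec W)} {b : Matrix κ ι (X.Sec W)}
    (hd : MatMem 0 d) (he : MatMem 0 e) (hc : MatMem 1 c) (hb : MatMem 1 b)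
    (h : c * b + d * e = 1) : IsUnit (d.map evenPart).det := by
  have h0 : MatMem 0 (c * b) := by
    have := hc.mul hb
    rwa [show (1 + 1 : ZMod 2) = 0 by decide] at this
  have hN : ∀ i j, (c * b).map evenPart i j ∈ nilradical (X.gr W 0) := fun i j => by
    have : (c * b).map evenPart i j = ∑ k, evenPart (c i k * b k j) := by
      apply Subtype.ext
      rw [Matrix.map_apply, evenPart_val (h0 i j), AddSubmonoidClass.coe_finsetSum,
        Matrix.mul_apply]
      refine Finset.sum_congr rfl fun k _ => (evenPart_val ?_).symm
      have := mul_mem_gr (hc i k) (hb k j)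
      rwa [show (1 + 1 : ZMod 2) = 0 by decide] at this
    rw [this]
    exact sum_mem fun k _ => isNilpotent_evenPart_mul (hc i k) (hb k j)
  have hde : (c * b).map evenPart + d.map evenPart * e.map evenPart = 1 := by
    apply map_val_injective
    change ((c * b).map evenPart + d.map evenPart * e.map evenPart).map (evenVal X W) = _
    rw [Matrix.map_add _ (map_add _)]
    change ((c * b).map evenPart).map Subtype.val +
      (d.map evenPart * e.map evenPart).map Subtype.val = Matrix.map 1 Subtype.val
    rw [map_val_mul, map_evenPart_map_val h0, map_evenPart_map_val hd,
      map_evenPart_map_val he, h, map_val_one]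
  let π := Ideal.Quotient.mk (nilradical (X.gr W 0))
  have hdet : π ((d.map evenPart).det * (e.map evenPart).det) = 1 := by
    rw [← Matrix.det_mul, RingHom.map_det, ← Matrix.det_one (n := ι)]
    congr 1
    rw [← map_one π.mapMatrix, ← hde, map_add]
    have : π.mapMatrix ((c * b).map evenPart) = 0 := by
      ext i j
      exact Ideal.Quotient.eq_zero_iff_mem.2 (hN i j)
    rw [this, zero_add]
  have hnil : IsNilpotent ((d.map evenPart).det * (e.map evenPart).det - 1) := by
    rw [← mem_nilradical, ← Ideal.Quotient.eq_zero_iff_mem, map_sub, map_one]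
    exact sub_eq_zero.2 hdet
  have := hnil.isUnit_one_add
  rw [add_sub_cancel] at this
  exact isUnit_of_mul_isUnit_left this

/-- The logarithmic derivative of the Berezinian in terms of blocks, where `e` is inverse to `d` and
`a'` is the upper left block of the inverse matrix. -/
theorem IsSuperDer.trace_schur {ι κ : Type*} [Fintype ι] [Fintype κ] [DecidableEq κ]
    {p : ZMod 2} {D : X.Sec W →ₗ[ℝ] X.Sec W} (hD : IsSuperDer (X.gr W) p D)
    {a a' : Matrix ι ι (X.Sec W)} {b : Matrix ι κ (X.Sec W)} {c : Matrix κ ι (X.Sec W)}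
    {d e : Matrix κ κ (X.Sec W)} (ma' : MatMem 0 a') (mb : MatMem 1 b) (mc : MatMem 1 c)
    (md : MatMem 0 d) (me : MatMem 0 e) (hde : d * e = 1) (hed : e * d = 1) :
    ((a - b * e * c).map D * a').trace + (e.map D * d).trace =
      (a.map D * a').trace + (b.map D * -(e * c * a')).trace -
        ((c.map D * -(a' * b * e)).trace +
          (d.map D * (e + e * c * a' * b * e)).trace) := by
  have hDe : e.map D = -(e * d.map D * e) := by
    have h1 := hD.map_matrix_mul me d
    rw [hed, hD.map_matrix_one, mul_zero, sgn_zero, one_smul] at h1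
    have h2 : (e.map D * d + e * d.map D) * e = 0 := by rw [← h1, Matrix.zero_mul]
    rw [Matrix.add_mul, Matrix.mul_assoc _ d, hde, Matrix.mul_one] at h2
    exact eq_neg_of_add_eq_zero_left h2
  -- The sign `(-1)^p` comes from `D` passing the odd block `b`.
  have hDs : (a - b * e * c).map D = a.map D - b.map D * e * c - sgn p • (b * e.map D * c) -
      sgn p • (b * e * c.map D) := by
    have h1 := hD.map_matrix_mul (mb.mul me) c
    rw [hD.map_matrix_mul mb e, add_zero, mul_one, Matrix.add_mul, Matrix.smul_mul] at h1
    rw [Matrix.map_sub _ (map_sub D), h1]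
    abel
  have tr1 : (e.map D * d).trace = -(d.map D * e).trace := by
    rw [hDe, Matrix.neg_mul, Matrix.mul_assoc (e * d.map D), hed, Matrix.mul_one,
      Matrix.trace_neg, trace_mul_comm_of_matMem me (hD.matMem_map md), zero_mul, sgn_zero,
      one_smul]
  -- Here and in `tr3` the odd matrix `b * e` is moved cyclically past a matrix of parity `p + 1`.
  -- The resulting `-(-1)^p` removes the Leibniz sign and leaves the minus sign with which the lower
  -- blocks enter the supertrace.
  have tr2 : (b * e * c.map D * a').trace = -(sgn p • (c.map D * (a' * b * e)).trace) := by
    rw [Matrix.mul_assoc (b * e),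
      trace_mul_comm_of_matMem (mb.mul me) ((hD.matMem_map mc).mul ma')]
    simp only [Matrix.mul_assoc]
    rw [← neg_smul]
    congr 1
    rcases zmod2_cases p with rfl | rfl <;> simp [sgn, show (1 + 1 : ZMod 2) = 0 by decide]
  have tr3 : (b * e.map D * c * a').trace =
      sgn p • (d.map D * (e * c * a' * b * e)).trace := by
    rw [hDe, Matrix.mul_neg, Matrix.neg_mul, Matrix.neg_mul, Matrix.trace_neg]
    have : b * (e * d.map D * e) * c * a' = (b * e) * (d.map D * (e * c * a')) := by
      simp only [Matrix.mul_assoc]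
    rw [this, trace_mul_comm_of_matMem (mb.mul me)
      ((hD.matMem_map md).mul ((me.mul mc).mul ma')), ← neg_smul]
    simp only [Matrix.mul_assoc]
    congr 1
    rcases zmod2_cases p with rfl | rfl <;> simp [sgn, show (1 + 1 : ZMod 2) = 0 by decide]
  have h1 : b.map D * e * c * a' = b.map D * (e * c * a') := by simp only [Matrix.mul_assoc]
  rw [hDs, tr1, Matrix.sub_mul, Matrix.sub_mul, Matrix.sub_mul,
    Matrix.smul_mul, Matrix.smul_mul, h1, Matrix.trace_sub, Matrix.trace_sub,
    Matrix.trace_sub, Matrix.trace_smul, Matrix.trace_smul, tr2, tr3, smul_neg, smul_smul,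
    smul_smul, sgn_mul_self, one_smul, one_smul, Matrix.mul_neg, Matrix.mul_neg,
    Matrix.mul_add, Matrix.trace_neg, Matrix.trace_neg, Matrix.trace_add]
  abel

/-- The super Jacobi formula. The Berezinian is the product of the determinants of two even
matrices, the Schur complement `s` and `d⁻¹`, to which the ordinary Jacobi formula applies; the
inverse of `s` is the upper left block of `K`. `trace_schur` identifies the sum of the two traces
with the supertrace of `DT · K`. -/
theorem IsSuperDer.map_berezinian {p : ZMod 2} {D : X.Sec W →ₗ[ℝ] X.Sec W}
    (hD : IsSuperDer (X.gr W) p D) {T K : Matrix (Idx n m) (Idx n m) (X.Sec W)}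
    (hT : ∀ i j, T i j ∈ X.gr W (par i + par j)) (hK : ∀ i j, K i j ∈ X.gr W (par i + par j))
    (hTK : T * K = 1) (hKT : K * T = 1) :
    D (berezinian T).1 =
      (∑ s, ∑ a, sgn (par s) • (D (T s a) * K a s)) * (berezinian T).1 := by
  obtain ⟨a, b, c, d, rfl⟩ : ∃ a b c d, T = Matrix.fromBlocks a b c d :=
    ⟨_, _, _, _, (Matrix.fromBlocks_toBlocks T).symm⟩
  obtain ⟨a', b', c', d', rfl⟩ : ∃ a b c d, K = Matrix.fromBlocks a b c d :=
    ⟨_, _, _, _, (Matrix.fromBlocks_toBlocks K).symm⟩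
  have h11 : (1 + 1 : ZMod 2) = 0 := by decide
  have ma : MatMem 0 a := fun i j => by simpa [par] using hT (Sum.inl i) (Sum.inl j)
  have mb : MatMem 1 b := fun i j => by simpa [par] using hT (Sum.inl i) (Sum.inr j)
  have mc : MatMem 1 c := fun i j => by simpa [par] using hT (Sum.inr i) (Sum.inl j)
  have md : MatMem 0 d := fun i j => by simpa [par, h11] using hT (Sum.inr i) (Sum.inr j)
  have ma' : MatMem 0 a' := fun i j => by simpa [par] using hK (Sum.inl i) (Sum.inl j)
  have mb' : MatMem 1 b' := fun i j => by simpa [par] using hK (Sum.inl i) (Sum.inr j)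
  have md' : MatMem 0 d' := fun i j => by simpa [par, h11] using hK (Sum.inr i) (Sum.inr j)
  rw [Matrix.fromBlocks_multiply, ← Matrix.fromBlocks_one, Matrix.fromBlocks_inj] at hTK hKT
  obtain ⟨t11, -, t21, t22⟩ := hTK
  obtain ⟨-, k12, -, k22⟩ := hKT
  have hu : IsUnit (d.map evenPart).det := isUnit_det_of_mul_add_mul md md' mc mb' t22
  set e : Matrix (Fin m) (Fin m) (X.Sec W) := (d.map evenPart)⁻¹.map Subtype.val with he
  have me : MatMem 0 e := matMem_map_val _
  have hde : d * e = 1 := by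
    rw [he, ← map_evenPart_map_val md, ← map_val_mul, map_evenPart_map_val md,
      Matrix.mul_nonsing_inv _ hu, map_val_one]
  have hed : e * d = 1 := by
    rw [he, ← map_evenPart_map_val md, ← map_val_mul, map_evenPart_map_val md,
      Matrix.nonsing_inv_mul _ hu, map_val_one]
  -- The other blocks of `K` are forced by `T * K = 1` and `K * T = 1`, and are expressed through
  -- `a'` and `e = d⁻¹`.
  have hc1 : c' = -(e * c * a') := by
    have : e * (c * a' + d * c') = 0 := by rw [t21, Matrix.mul_zero]
    rw [Matrix.mul_add, ← Matrix.mul_assoc e d, hed, Matrix.one_mul, ← Matrix.mul_assoc] at this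
    exact eq_neg_of_add_eq_zero_right this
  have hb1 : b' = -(a' * b * e) := by
    have : (a' * b + b' * d) * e = 0 := by rw [k12, Matrix.zero_mul]
    rw [Matrix.add_mul, Matrix.mul_assoc b', hde, Matrix.mul_one] at this
    exact eq_neg_of_add_eq_zero_right this
  have hd1 : d' = e + e * c * a' * b * e := by
    have : (c' * b + d' * d) * e = e := by rw [k22, Matrix.one_mul]
    rw [Matrix.add_mul, Matrix.mul_assoc d', hde, Matrix.mul_one, hc1, Matrix.neg_mul,
      Matrix.neg_mul, neg_add_eq_iff_eq_add] at this
    exact this.trans (add_comm _ _)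
  set s := a - b * e * c with hs
  have ms : MatMem 0 s := ma.sub (by
    have := (mb.mul me).mul mc
    rwa [show (1 + 0 + 1 : ZMod 2) = 0 by decide] at this)
  have hsa : s * a' = 1 := by
    rw [hs, Matrix.sub_mul, ← t11, hc1]
    simp only [Matrix.mul_neg, Matrix.mul_assoc]
    abel
  have hs0 : s.map evenPart * a'.map evenPart = 1 := by
    apply map_val_injective
    change (s.map evenPart * a'.map evenPart).map Subtype.val = Matrix.map 1 Subtype.val
    rw [map_val_mul, map_evenPart_map_val ms, map_evenPart_map_val ma', hsa, map_val_one]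
  have hdet1 := hD.map_det hs0
  rw [map_evenPart_map_val ms, map_evenPart_map_val ma'] at hdet1
  have hdet2 := hD.map_det (Matrix.nonsing_inv_mul _ hu)
  rw [← he, map_evenPart_map_val md] at hdet2
  have hber : (berezinian (Matrix.fromBlocks a b c d)).1 =
      (s.map evenPart).det.1 * ((d.map evenPart)⁻¹).det.1 := rfl
  have hsum : ∑ s, ∑ k, sgn (par s) •
      (D (Matrix.fromBlocks a b c d s k) * Matrix.fromBlocks a' b' c' d' k s) =
      (a.map D * a').trace + (b.map D * c').trace -
        ((c.map D * b').trace + (d.map D * d').trace) := by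
    simp only [Fintype.sum_sum_type, par, sgn_zero, one_smul, Matrix.trace, Matrix.diag_apply,
      Matrix.mul_apply, Matrix.map_apply, Finset.sum_add_distrib,
      show sgn 1 = -1 by simp [sgn], neg_smul, Finset.sum_neg_distrib,
      Matrix.fromBlocks_apply₁₁, Matrix.fromBlocks_apply₁₂, Matrix.fromBlocks_apply₂₁,
      Matrix.fromBlocks_apply₂₂]
    abel
  have h0 := hD.2 0 _ (s.map evenPart).det.2 ((d.map evenPart)⁻¹).det.1
  rw [mul_zero, sgn_zero, one_smul, hdet1, hdet2] at h0
  rw [hber, h0, hsum, hb1, hc1, hd1, ← hD.trace_schur ma' mb mc md me hde hed,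
    add_mul, mul_assoc, add_right_inj, ← mul_assoc, even_comm, mul_assoc,
    even_comm]

end Berezinian

/-- The projective class of a connection. -/
def SymConnection.projClass (C : SymConnection X) (n m : ℕ) : ProjectiveClass X n m :=
  Quotient.mk (projSetoid X n m) C

/-! ### The covariant divergence of a tensor -/

section CovariantDivergence

variable {W : Opens M} (C : SymConnection X) {ε : ZMod 2} (S : SymTensor X ε)

namespace Chart

variable (φ ψ : Chart X n m) (hφ : W ≤ φ.dom) (hψ : W ≤ ψ.dom)

theorem tensorCoeff_mem (i j : Idx n m) :
    φ.tensorCoeff hφ S i j ∈ X.gr W (ε + par i + par j) :=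
  S.app_d_mem (φ.coord_mem hφ i) (φ.coord_mem hφ j)

theorem tensorCoeff_symm (i j : Idx n m) :
    φ.tensorCoeff hφ S i j = sgn (par i * par j) • φ.tensorCoeff hφ S j i :=
  S.symm_d (φ.coord_mem hφ i) (φ.coord_mem hφ j)

/-- The contraction `S^{jk} Γ^i_{kj}` with the coefficients of a connection. -/
def contractChristoffel (i : Idx n m) : X.Sec W :=
  ∑ j, ∑ k, φ.tensorCoeff hφ S j k * φ.christoffel hφ C k j i

/-- The contraction `S^{ij} τ_j`, where `τ_j = Γ^s_{js} (-1)^s`. -/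
def tensorContraction (i : Idx n m) : X.Sec W :=
  ∑ j, φ.tensorCoeff hφ S i j * φ.contraction C hφ j

/-- The covariant divergence `∇_j S^{ji}` of a tensor, as a vector field. -/
def covDiv : Der X W :=
  ∑ i, (φ.divTensor hφ S i + φ.contractChristoffel C S hφ i +
    φ.tensorContraction C S hφ i) • φ.pd hφ i

theorem covDiv_coord (i : Idx n m) : (φ.covDiv C S hφ).1 (φ.coord hφ i) =
    φ.divTensor hφ S i + φ.contractChristoffel C S hφ i + φ.tensorContraction C S hφ i := by
  rw [covDiv, sum_smul_apply]
  simp [pd_coord]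

/-- The vector field `g ↦ S(df, dg)`. -/
def gradient (f : X.Sec W) : Der X W :=
  ∑ j, S.app W (OneForm.d f) (OneForm.d (φ.coord hφ j)) • φ.pd hφ j

theorem gradient_apply (f g : X.Sec W) :
    (φ.gradient S hφ f).1 g = S.app W (OneForm.d f) (OneForm.d g) := by
  rw [gradient, sum_smul_apply, S.app_d φ hφ]

theorem gradient_eq (f : X.Sec W) : φ.gradient S hφ f = ψ.gradient S hψ f := by
  apply Subtype.ext
  ext g
  rw [gradient_apply, gradient_apply]

theorem gradient_hasParity {q : ZMod 2} {f : X.Sec W} (hf : f ∈ X.gr W q) :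
    Der.HasParity (ε + q) (φ.gradient S hφ f) := by
  refine Der.HasParity.sum fun j _ => ?_
  have := Der.HasParity.smul (S.app_d_mem hf (φ.coord_mem hφ j)) (φ.pd_hasParity hφ j)
  rwa [add_assoc, CharTwo.add_self_eq_zero, add_zero] at this

theorem hessTrace_eq_sub (f : X.Sec W) : φ.hessTrace C S hφ f =
    ∑ i, ∑ j, φ.tensorCoeff hφ S i j * (φ.pd hφ j).1 ((φ.pd hφ i).1 f) -
      ∑ i, φ.contractChristoffel C S hφ i * (φ.pd hφ i).1 f := by
  have h : ∀ i j, hess C (φ.pd hφ j) (φ.pd hφ i) f = (φ.pd hφ j).1 ((φ.pd hφ i).1 f) -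
      ∑ k, φ.christoffel hφ C j i k * (φ.pd hφ k).1 f := fun i j => by
    rw [hess, φ.der_apply hφ (C.cov W (φ.pd hφ j) (φ.pd hφ i))]
    rfl
  simp_rw [hessTrace, h, mul_sub, Finset.sum_sub_distrib, contractChristoffel, Finset.sum_mul,
    Finset.mul_sum, mul_assoc]
  congr 1
  symm
  rw [Finset.sum_comm]
  exact Finset.sum_congr rfl fun i _ => Finset.sum_comm

/-- In the divergence of the gradient of `f`, derivatives falling on `S` and the `τ` terms belong to
`V f`, and second derivatives of `f` to the Hessian. The terms `S^{jk} Γ^i_{kj}` enter these two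
with opposite signs and cancel. -/
theorem covDiv_add_hessTrace {q : ZMod 2} {f : X.Sec W} (hf : f ∈ X.gr W q) :
    (φ.covDiv C S hφ).1 f + φ.hessTrace C S hφ f =
      φ.superTrace hφ (ε + q) (covLeft C (φ.gradient S hφ f)) := by
  have hg : ∀ k, (φ.gradient S hφ f).1 (φ.coord hφ k) =
      sgn (q * par k) • ∑ i, φ.tensorCoeff hφ S k i * (φ.pd hφ i).1 f := fun k => by
    rw [gradient_apply, S.symm_d hf (φ.coord_mem hφ k), S.app_d φ hφ]
    rfl
  have h1 : ∀ j, sgn (par j * (1 + (ε + q))) •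
      (φ.pd hφ j).1 ((φ.gradient S hφ f).1 (φ.coord hφ j)) =
      ∑ i, (sgn (par j * (ε + 1)) • (φ.pd hφ j).1 (φ.tensorCoeff hφ S j i)) *
        (φ.pd hφ i).1 f +
      ∑ i, φ.tensorCoeff hφ S i j * (φ.pd hφ j).1 ((φ.pd hφ i).1 f) := fun j => by
    rw [hg, map_smul, smul_smul, map_sum, Finset.smul_sum, ← Finset.sum_add_distrib]
    refine Finset.sum_congr rfl fun i _ => ?_
    rw [φ.pd_mul hφ j (φ.tensorCoeff_mem S hφ j i), smul_add, ← sgn_add, smul_smul, ← sgn_add,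
      φ.tensorCoeff_symm S hφ i j, smul_mul_assoc, smul_mul_assoc]
    refine congrArg₂ _ (sgn_smul_congr ?_ rfl) (sgn_smul_congr ?_ rfl)
    · generalize par j = j, ε = e, q = r
      revert j e r; decide
    · generalize par j = j, par i = i, ε = e, q = r
      revert i j e r; decide
  have h2 : ∀ k, (φ.gradient S hφ f).1 (φ.coord hφ k) * φ.contraction C hφ k =
      ∑ i, φ.tensorCoeff hφ S i k * φ.contraction C hφ k * (φ.pd hφ i).1 f := fun k => by
    rw [hg, smul_mul_assoc, Finset.sum_mul, Finset.smul_sum]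
    refine Finset.sum_congr rfl fun i _ => ?_
    rw [mul_assoc, X.supercomm W _ _ _ (φ.pd_mem hφ i hf) _ (φ.contraction_mem C hφ k),
      mul_smul_comm, smul_smul, ← sgn_add, φ.tensorCoeff_symm S hφ i k, smul_mul_assoc,
      smul_mul_assoc, mul_assoc]
    refine sgn_smul_congr ?_ rfl
    generalize par k = k, par i = i, q = r
    revert i k r; decide
  rw [φ.superTrace_covLeft C hφ (φ.gradient_hasParity S hφ hf), hessTrace_eq_sub, covDiv,
    sum_smul_apply]
  simp_rw [h1, h2, add_mul, Finset.sum_add_distrib, divTensor, tensorContraction,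
    Finset.sum_mul]
  rw [Finset.sum_comm (f := fun j i => (sgn (par j * (ε + 1)) •
      (φ.pd hφ j).1 (φ.tensorCoeff hφ S j i)) * (φ.pd hφ i).1 f),
    Finset.sum_comm (f := fun j i => φ.tensorCoeff hφ S i j *
      (φ.pd hφ j).1 ((φ.pd hφ i).1 f)),
    Finset.sum_comm (f := fun k i => φ.tensorCoeff hφ S i k * φ.contraction C hφ k *
      (φ.pd hφ i).1 f)]
  abel

/-- In `covDiv_add_hessTrace` the supertrace and the trace of the Hessian are invariant, hence so is
the remaining term. Testing on coordinates keeps the argument homogeneous. -/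
theorem covDiv_eq : φ.covDiv C S hφ = ψ.covDiv C S hψ := by
  refine φ.der_ext hφ fun i => ?_
  have h1 := φ.covDiv_add_hessTrace C S hφ (φ.coord_mem hφ i)
  have h2 := ψ.covDiv_add_hessTrace C S hψ (φ.coord_mem hφ i)
  rw [← φ.hessTrace_eq C S ψ hφ hψ, ← φ.gradient_eq S ψ hφ hψ,
    ← φ.superTrace_eq ψ hφ hψ (p := ε + par i) (fun q D hD => C.parity W _ _ _ _ hD
      (φ.gradient_hasParity S hφ (φ.coord_mem hφ i))), ← h1] at h2
  exact (add_right_cancel h2).symm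

/-! ### The coordinate expressions in terms of a connection -/

/-- The two Kronecker terms of `Π` contribute the same quantity because `S` is supersymmetric,
whence the factor `2`. -/
theorem contractTensor_mk (i : Idx n m) :
    φ.contractTensor hφ S (C.projClass n m) i =
      φ.contractChristoffel C S hφ i -
        (2 * ((n : ℝ) - m + 1)⁻¹) • φ.tensorContraction C S hφ i := by
  have h : ∀ j k, φ.projCoeff hφ (C.projClass n m) k j i =
      φ.christoffel hφ C k j i - ((n : ℝ) - m + 1)⁻¹ •
        ((if i = j then φ.contraction C hφ k else 0) +
        (if i = k then sgn (par k * par j) • φ.contraction C hφ j else 0)) := fun j k => by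
    simp only [contraction, Finset.smul_sum, smul_smul, ← sgn_add]
    rw [mul_comm (par k)]
    rfl
  simp_rw [contractTensor, h, mul_sub, Finset.sum_sub_distrib, mul_smul_comm, mul_add,
    ← Finset.smul_sum, Finset.sum_add_distrib, mul_ite, mul_zero]
  rw [mul_comm (2 : ℝ), mul_smul, two_smul, contractChristoffel, tensorContraction]
  congr 3
  · rw [Finset.sum_comm]; simp
  · simp only [Finset.sum_ite_eq, Finset.mem_univ, if_true]
    refine Finset.sum_congr rfl fun j _ => ?_
    rw [φ.tensorCoeff_symm S hφ i j, mul_smul_comm, smul_mul_assoc]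

/-- With `N = n - m`, the coefficient of `S^{ij} τ_j` is `(N+1)/(N+3) · 2/(N+1) = 2/(N+3)`, the same
as that of the divergence. The coefficient of `S^{jk} Γ^i_{kj}` is `-(N+1)/(N+3) = 2/(N+3) - 1`, and
the `-1` completes the Hessian. -/
theorem laplacian_mk (h1 : (n : ℝ) - m + 1 ≠ 0) (h3 : (n : ℝ) - m + 3 ≠ 0) (f : X.Sec W) :
    φ.laplacian hφ S (C.projClass n m) f =
      φ.hessTrace C S hφ f + (2 / ((n : ℝ) - m + 3)) • (φ.covDiv C S hφ).1 f := by
  have h : ∀ i, (2 / ((n : ℝ) - m + 3)) • φ.divTensor hφ S i -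
      (((n : ℝ) - m + 1) / ((n : ℝ) - m + 3)) • φ.contractTensor hφ S (C.projClass n m) i =
      (2 / ((n : ℝ) - m + 3)) • (φ.divTensor hφ S i + φ.contractChristoffel C S hφ i +
        φ.tensorContraction C S hφ i) - φ.contractChristoffel C S hφ i := fun i => by
    rw [contractTensor_mk]
    match_scalars <;> field_simp
    ring
  simp_rw [laplacian, h, sub_mul, smul_mul_assoc, Finset.sum_sub_distrib, ← Finset.smul_sum]
  rw [hessTrace_eq_sub, covDiv, sum_smul_apply]
  abel

/-- The coefficient of `S^{ij} τ_j` is `-2/(N+3) = (N+1)/(N+3) - 1` with `N = n - m`. The `-1` is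
the coefficient that the transition function of the volume bundle requires. -/
theorem upperCoeff_mk (h1 : (n : ℝ) - m + 1 ≠ 0) (h3 : (n : ℝ) - m + 3 ≠ 0) (i : Idx n m) :
    φ.upperCoeff hφ S (C.projClass n m) i =
      (((n : ℝ) - m + 1) / ((n : ℝ) - m + 3)) • (φ.covDiv C S hφ).1 (φ.coord hφ i) -
        φ.tensorContraction C S hφ i := by
  rw [upperCoeff, contractTensor_mk, covDiv_coord]
  match_scalars <;> field_simp
  ring

/-! ### The trace of a connection in a coordinate system -/

/-- The one-form `dx^i τ_i`, where `τ_i = Γ^s_{is} (-1)^s`. -/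
def traceForm : OneForm X W := ∑ i, (OneForm.d (φ.coord hφ i)).mulRight (φ.contraction C hφ i)

theorem traceForm_pd (i : Idx n m) :
    (φ.traceForm C hφ).app W le_rfl (φ.pd hφ i) = φ.contraction C hφ i := by
  rw [traceForm, OneForm.sum_app]
  simp [OneForm.mulRight_app_self, OneForm.d_app_self, pd_coord]

theorem traceForm_hasParity : (φ.traceForm C hφ).HasParity 0 := by
  refine OneForm.HasParity.sum fun i _ => ?_
  have := (OneForm.hasParity_d (φ.coord_mem hφ i)).mulRight (φ.contraction_mem C hφ i)
  rwa [CharTwo.add_self_eq_zero] at this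

theorem cov_sum_right_apply {ι : Type*} (s : Finset ι) (a : ι → X.Sec W) (q : ι → ZMod 2)
    (ha : ∀ i, a i ∈ X.gr W (q i)) {p : ZMod 2} {D : Der X W} (hD : Der.HasParity p D)
    (E : ι → Der X W) (f : X.Sec W) : (C.cov W D (∑ i ∈ s, a i • E i)).1 f =
      ∑ i ∈ s, (D.1 (a i) * (E i).1 f + sgn (p * q i) • (a i * (C.cov W D (E i)).1 f)) := by
  refine (map_sum (AddMonoidHom.mk' (fun E => (C.cov W D E).1 f) fun E E' => ?_) _ s).trans
    (Finset.sum_congr rfl fun i _ => ?_)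
  · rw [C.add_right]; rfl
  · change (C.cov W D (a i • E i)).1 f = _
    rw [C.leibniz W p (q i) D (a i) (E i) hD (ha i)]
    rfl

/-- The trace of the transformation law of the Christoffel symbols. The inhomogeneous part contracts
second derivatives of `y` with the inverse Jacobian, which gives the supertrace appearing in the
super Jacobi formula. -/
theorem contraction_eq (i : Idx n m) : φ.contraction C hφ i =
    ∑ a, φ.jac ψ hφ hψ i a * ψ.contraction C hψ a +
      ∑ s, ∑ a, sgn (par s) • ((φ.pd hφ i).1 (φ.jac ψ hφ hψ s a) * ψ.jac φ hψ hφ a s) := by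
  have h1 : ∀ s, φ.christoffel hφ C i s s =
      ∑ a, ((φ.pd hφ i).1 (φ.jac ψ hφ hψ s a) * ψ.jac φ hψ hφ a s +
        sgn (par i * (par s + par a)) • (φ.jac ψ hφ hψ s a *
          (C.cov W (φ.pd hφ i) (ψ.pd hψ a)).1 (φ.coord hφ s))) := fun s => by
    rw [christoffel, φ.pd_eq_sum ψ hφ hψ s, cov_sum_right_apply C _ _ _
      (φ.jac_mem ψ hφ hψ s) (φ.pd_hasParity hφ i)]
    rfl
  have h2 : ∀ s a, (C.cov W (φ.pd hφ i) (ψ.pd hψ a)).1 (φ.coord hφ s) =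
      ∑ c, ∑ b, φ.jac ψ hφ hψ i c * ψ.christoffel hψ C c a b * ψ.jac φ hψ hφ b s :=
    fun s a => by
      change (covLeft C (ψ.pd hψ a) (φ.pd hφ i)).1 (φ.coord hφ s) = _
      rw [φ.pd_eq_sum ψ hφ hψ i, map_sum]
      simp_rw [map_smul]
      rw [sum_smul_apply]
      refine Finset.sum_congr rfl fun c _ => ?_
      rw [ψ.der_apply hψ, Finset.mul_sum]
      refine Finset.sum_congr rfl fun b _ => ?_
      rw [mul_assoc]
      rfl
  -- As for the supertrace, the inverse Jacobian is moved to the front, after which the sign is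
  -- independent of `s` and the sum over `s` is the identity matrix.
  have h3 : ∀ s a c b, sgn (par s) • sgn (par i * (par s + par a)) • (φ.jac ψ hφ hψ s a *
      (φ.jac ψ hφ hψ i c * ψ.christoffel hψ C c a b * ψ.jac φ hψ hφ b s)) =
      sgn (par i * par a + par b * par i + par b) • (ψ.jac φ hψ hφ b s * φ.jac ψ hφ hψ s a *
        (φ.jac ψ hφ hψ i c * ψ.christoffel hψ C c a b)) := fun s a c b => by
    rw [← mul_assoc (φ.jac ψ hφ hψ s a), X.supercomm W _ _ _ (mul_mem_gr
      (φ.jac_mem ψ hφ hψ s a) (mul_mem_gr (φ.jac_mem ψ hφ hψ i c)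
        (ψ.christoffel_mem C hψ c a b))) _ (ψ.jac_mem φ hψ hφ b s), smul_smul, smul_smul,
      ← sgn_add, ← sgn_add, ← mul_assoc]
    refine sgn_smul_congr ?_ rfl
    generalize par s = s, par i = i, par a = a, par b = b, par c = c
    revert s i a b c; decide
  have h4 : ∑ s, ∑ a, sgn (par s) • sgn (par i * (par s + par a)) • (φ.jac ψ hφ hψ s a *
      (C.cov W (φ.pd hφ i) (ψ.pd hψ a)).1 (φ.coord hφ s)) =
      ∑ c, φ.jac ψ hφ hψ i c * ψ.contraction C hψ c := by
    simp_rw [h2, Finset.mul_sum, Finset.smul_sum, h3, contraction, Finset.mul_sum]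
    rw [Finset.sum_comm]
    conv_rhs => rw [Finset.sum_comm]
    refine Finset.sum_congr rfl fun a _ => ?_
    rw [Finset.sum_comm]
    refine Finset.sum_congr rfl fun c _ => ?_
    rw [Finset.sum_comm]
    simp_rw [← Finset.smul_sum, ← Finset.sum_mul, sum_jac_mul_jac, ite_mul, one_mul, zero_mul,
      smul_ite, smul_zero]
    rw [Finset.sum_ite_eq Finset.univ a, if_pos (Finset.mem_univ a), mul_smul_comm]
    refine sgn_smul_congr ?_ rfl
    generalize par i = i, par a = a
    revert i a; decide
  rw [contraction]
  simp_rw [h1, Finset.smul_sum, smul_add, Finset.sum_add_distrib]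
  rw [h4, add_comm]

theorem pd_berJacobian (i : Idx n m) : (φ.pd hφ i).1 (berJacobian φ ψ hφ hψ) =
    (∑ s, ∑ a, sgn (par s) • ((φ.pd hφ i).1 (φ.jac ψ hφ hψ s a) * ψ.jac φ hψ hφ a s)) *
      berJacobian φ ψ hφ hψ := by
  refine (φ.pd_hasParity hφ i).map_berezinian (T := Matrix.of (φ.jac ψ hφ hψ))
    (K := Matrix.of (ψ.jac φ hψ hφ)) (φ.jac_mem ψ hφ hψ) (ψ.jac_mem φ hψ hφ) ?_ ?_
  · ext i k
    rw [Matrix.mul_apply, Matrix.one_apply]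
    exact (φ.sum_jac_mul_jac ψ hφ hψ i k).trans (by simp only [eq_comm])
  · ext i k
    rw [Matrix.mul_apply, Matrix.one_apply]
    exact (ψ.sum_jac_mul_jac φ hψ hφ i k).trans (by simp only [eq_comm])

/-- The trace form changes by the logarithmic differential of the Berezinian. -/
theorem traceForm_transition : (φ.traceForm C hφ).mulRight (berJacobian φ ψ hφ hψ) =
    (ψ.traceForm C hψ).mulRight (berJacobian φ ψ hφ hψ) +
      OneForm.d (berJacobian φ ψ hφ hψ) := by
  -- Both sides carry the factor `Ber`, so the logarithmic differential is handled without dividing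
  -- by the Berezinian.
  refine φ.oneForm_ext hφ fun i => ?_
  have h : (ψ.traceForm C hψ).app W le_rfl (φ.pd hφ i) =
      ∑ a, φ.jac ψ hφ hψ i a * ψ.contraction C hψ a := by
    rw [φ.pd_eq_sum ψ hφ hψ i, map_sum]
    simp_rw [map_smul, traceForm_pd]
    rfl
  rw [OneForm.add_app, OneForm.mulRight_app_self, OneForm.mulRight_app_self,
    OneForm.d_app_self, traceForm_pd, h, pd_berJacobian, ← add_mul, ← contraction_eq]

end Chart

end CovariantDivergence

/-! ### Compatibility with restriction -/

section Restriction

variable {W W' : Opens M} (C : SymConnection X) {ε : ZMod 2} (S : SymTensor X ε)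

theorem res_hess (h : W' ≤ W) {D E : Der X W} {D' E' : Der X W'} (hD : Der.Restricts h D D')
    (hE : Der.Restricts h E E') (f : X.Sec W) :
    X.res h (hess C D E f) = hess C D' E' (X.res h f) := by
  rw [hess, hess, map_sub, hD, hE, C.natural h D E D' E' hD hE]

namespace Chart

variable (φ : Chart X n m) (hφ : W ≤ φ.dom) (h : W' ≤ W)

theorem res_tensorCoeff (i j : Idx n m) :
    X.res h (φ.tensorCoeff hφ S i j) = φ.tensorCoeff (h.trans hφ) S i j := by
  rw [tensorCoeff, S.natural, OneForm.restrict_d, OneForm.restrict_d, res_coord, res_coord]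
  rfl

theorem res_christoffel (i j k : Idx n m) :
    X.res h (φ.christoffel hφ C i j k) = φ.christoffel (h.trans hφ) C i j k := by
  rw [christoffel, C.natural h _ _ _ _ (φ.res_pd hφ h i) (φ.res_pd hφ h j), res_coord]
  rfl

theorem res_contraction (i : Idx n m) :
    X.res h (φ.contraction C hφ i) = φ.contraction C (h.trans hφ) i := by
  simp only [contraction, map_sum, map_smul, res_christoffel]

theorem res_divTensor (i : Idx n m) :
    X.res h (φ.divTensor hφ S i) = φ.divTensor (h.trans hφ) S i := by
  simp only [divTensor, map_sum, map_smul]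
  simp_rw [fun j => φ.res_pd hφ h j (φ.tensorCoeff hφ S j i), res_tensorCoeff]

theorem res_contractChristoffel (i : Idx n m) :
    X.res h (φ.contractChristoffel C S hφ i) = φ.contractChristoffel C S (h.trans hφ) i := by
  simp only [contractChristoffel, map_sum, map_mul, res_tensorCoeff, res_christoffel]

theorem res_tensorContraction (i : Idx n m) :
    X.res h (φ.tensorContraction C S hφ i) = φ.tensorContraction C S (h.trans hφ) i := by
  simp only [tensorContraction, map_sum, map_mul, res_tensorCoeff, res_contraction]

theorem res_covDiv : Der.Restricts h (φ.covDiv C S hφ) (φ.covDiv C S (h.trans hφ)) := fun f => by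
  rw [covDiv, covDiv, sum_smul_apply, sum_smul_apply, map_sum]
  refine Finset.sum_congr rfl fun i _ => ?_
  rw [map_mul, map_add, map_add, φ.res_pd hφ h i f, res_divTensor, res_contractChristoffel,
    res_tensorContraction]

theorem res_hessTrace (f : X.Sec W) :
    X.res h (φ.hessTrace C S hφ f) = φ.hessTrace C S (h.trans hφ) (X.res h f) := by
  simp_rw [hessTrace, map_sum, map_mul, res_tensorCoeff,
    fun i j => res_hess C h (φ.res_pd hφ h j) (φ.res_pd hφ h i) f]

theorem restrict_traceForm :
    (φ.traceForm C hφ).restrict h = φ.traceForm C (h.trans hφ) := by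
  refine φ.oneForm_ext (h.trans hφ) fun i => ?_
  rw [traceForm_pd, ← res_contraction C φ hφ h, ← traceForm_pd]
  exact ((φ.traceForm C hφ).natural le_rfl h _ _ (φ.res_pd hφ h i)).symm

end Chart

end Restriction

/-! ### The projective Laplacian -/

theorem real_ne_zero_of_int {n m : ℕ} {k : ℤ} (h : (n : ℤ) - m ≠ -k) : (n : ℝ) - m + k ≠ 0 := by
  intro h'
  apply h
  have : (((n : ℤ) - m + k : ℤ) : ℝ) = 0 := by push_cast; exact h'
  have := Int.cast_eq_zero.1 this
  omega

namespace SuperSpace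

variable {U : Opens M}

theorem glue_of_iSup_eq {ι : Type u} (V : ι → Opens M) (hV : ∀ i, V i ≤ U) (hU : iSup V = U)
    (s : ∀ i, X.Sec (V i)) (hs : ∀ i j,
      X.res (inf_le_left : V i ⊓ V j ≤ V i) (s i) = X.res inf_le_right (s j)) :
    ∃! t : X.Sec U, ∀ i, X.res (hV i) t = s i := by
  subst hU
  exact X.glue V s hs

end SuperSpace

namespace IsSupermanifold

variable {U : Opens M}

/-- Sections are glued over one chosen chart around each point: this cover is indexed by `M`, as the
universe in the sheaf axiom demands, whereas the type of all charts may be too large. -/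
theorem existsUnique_of_charts (hX : IsSupermanifold X n m)
    (s : ∀ (φ : Chart X n m) (W : Opens M), W ≤ U → W ≤ φ.dom → X.Sec W)
    (hres : ∀ φ W W' (hU : W ≤ U) (hφ : W ≤ φ.dom) (h : W' ≤ W),
      X.res h (s φ W hU hφ) = s φ W' (h.trans hU) (h.trans hφ))
    (heq : ∀ φ ψ W (hU : W ≤ U) (hφ : W ≤ φ.dom) (hψ : W ≤ ψ.dom),
      s φ W hU hφ = s ψ W hU hψ) :
    ∃! t : X.Sec U, ∀ φ W (hU : W ≤ U) (hφ : W ≤ φ.dom), X.res hU t = s φ W hU hφ := by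
  choose c hc using hX.exists_chart
  have hcov : ∀ W : Opens M, ⨆ x, W ⊓ (c x).dom = W := fun W => by
    refine le_antisymm (iSup_le fun x => inf_le_left) fun x hx => ?_
    exact Opens.mem_iSup.2 ⟨x, hx, hc x⟩
  obtain ⟨t, ht, hu⟩ := SuperSpace.glue_of_iSup_eq (U := U) (fun x => U ⊓ (c x).dom)
    (fun x => inf_le_left) (hcov U) (fun x => s (c x) _ inf_le_left inf_le_right)
    (fun x y => by rw [hres, hres]; exact heq _ _ _ _ _ _)
  refine ⟨t, fun φ W hU hφ => ?_, fun t' ht' => hu t' fun x => ht' _ _ _ _⟩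
  -- For a chart outside the chosen cover, both sections over `W` have the same restrictions to the
  -- sets `W ⊓ (c x).dom`, so uniqueness of gluing over `W` identifies them.
  refine (SuperSpace.glue_of_iSup_eq (U := W) (fun x => W ⊓ (c x).dom) (fun x => inf_le_left)
    (hcov W) (fun x => s (c x) _ (inf_le_left.trans hU) inf_le_right)
    (fun x y => by rw [hres, hres]; exact heq _ _ _ _ _ _)).unique (fun x => ?_) (fun x => ?_)
  · have hle : W ⊓ (c x).dom ≤ U ⊓ (c x).dom := inf_le_inf_right _ hU
    rw [X.res_res, ← X.res_res inf_le_left hle, ht, hres]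
  · rw [hres]; exact heq _ _ _ _ _ _

theorem sec_ext (hX : IsSupermanifold X n m) {f g : X.Sec U}
    (h : ∀ (φ : Chart X n m) (W : Opens M) (hU : W ≤ U),
    W ≤ φ.dom → X.res hU f = X.res hU g) : f = g :=
  (hX.existsUnique_of_charts (fun _ _ hU _ => X.res hU g)
    (fun _ _ _ _ _ _ => X.res_res _ _ _) (fun _ _ _ _ _ _ => rfl)).unique
    (fun φ W hU hφ => h φ W hU hφ) (fun _ _ _ _ => rfl)

/-- An operator on functions is given by a compatible family of operators in the coordinate
systems. -/
theorem existsUnique_operator (hX : IsSupermanifold X n m)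
    (L : ∀ (φ : Chart X n m) (W : Opens M), W ≤ φ.dom → X.Sec W →ₗ[ℝ] X.Sec W)
    (hres : ∀ φ W W' (hφ : W ≤ φ.dom) (h : W' ≤ W) f,
      X.res h (L φ W hφ f) = L φ W' (h.trans hφ) (X.res h f))
    (heq : ∀ φ ψ W (hφ : W ≤ φ.dom) (hψ : W ≤ ψ.dom) f, L φ W hφ f = L ψ W hψ f) :
    ∃! Δ : Operator X, ∀ φ W (hφ : W ≤ φ.dom) f, Δ.app W f = L φ W hφ f := by
  have key : ∀ (U : Opens M) (f : X.Sec U), ∃! t : X.Sec U,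
      ∀ φ W (hU : W ≤ U) (hφ : W ≤ φ.dom), X.res hU t = L φ W hφ (X.res hU f) := fun U f =>
    hX.existsUnique_of_charts (fun φ W hU hφ => L φ W hφ (X.res hU f))
      (fun φ W W' hU hφ h => by rw [hres, X.res_res]) (fun φ ψ W hU hφ hψ => heq φ ψ W hφ hψ _)
  choose Δ hΔ _ using key
  refine ⟨⟨fun U => ⟨⟨Δ U, fun f g => ?_⟩, fun r f => ?_⟩, fun {U V} h f => ?_⟩, ?_, ?_⟩
  · refine hX.sec_ext fun φ W hU hφ => ?_
    rw [map_add, hΔ U _ φ W hU hφ, hΔ U _ φ W hU hφ, hΔ U _ φ W hU hφ, map_add, map_add]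
  · refine hX.sec_ext fun φ W hU hφ => ?_
    change X.res hU (Δ U (r • f)) = X.res hU (r • Δ U f)
    rw [map_smul, hΔ U _ φ W hU hφ, hΔ U _ φ W hU hφ, map_smul, map_smul]
  · refine hX.sec_ext fun φ W hU hφ => ?_
    change X.res hU (X.res h (Δ U f)) = X.res hU (Δ V (X.res h f))
    rw [X.res_res, hΔ U _ φ W _ hφ, hΔ V _ φ W hU hφ, X.res_res]
  · intro φ W hφ f
    change Δ W f = _
    have := hΔ W f φ W le_rfl hφ
    rwa [X.res_self, X.res_self] at this
  · intro Δ' hΔ'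
    ext U f
    refine hX.sec_ext fun φ W hU hφ => ?_
    change X.res hU (Δ'.app U f) = X.res hU (Δ U f)
    rw [Δ'.natural, hΔ' φ W hφ, hΔ U _ φ W hU hφ]

end IsSupermanifold

namespace Chart

variable {W W' : Opens M} {ε : ZMod 2} (φ ψ : Chart X n m)
  (S : SymTensor X ε) (P : ProjectiveClass X n m) (hφ : W ≤ φ.dom) (hψ : W ≤ ψ.dom)

/-- The projective Laplacian in a coordinate system, as a linear operator. -/
def laplacianLin : X.Sec W →ₗ[ℝ] X.Sec W where
  toFun := φ.laplacian hφ S P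
  map_add' f g := by
    simp only [laplacian, map_add, mul_add, Finset.sum_add_distrib]; abel
  map_smul' r f := by
    simp only [laplacian, map_smul, mul_smul_comm, ← Finset.smul_sum, ← smul_add,
      RingHom.id_apply]

theorem res_laplacian (h1 : (n : ℝ) - m + 1 ≠ 0) (h3 : (n : ℝ) - m + 3 ≠ 0)
    (h : W' ≤ W) (f : X.Sec W) :
    X.res h (φ.laplacian hφ S P f) = φ.laplacian (h.trans hφ) S P (X.res h f) := by
  obtain ⟨C, rfl⟩ := Quotient.exists_rep P
  refine (congrArg _ (φ.laplacian_mk C S hφ h1 h3 f)).trans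
    (Eq.trans ?_ (φ.laplacian_mk C S (h.trans hφ) h1 h3 _).symm)
  rw [map_add, map_smul, res_hessTrace, φ.res_covDiv C S hφ h]

theorem laplacian_eq (h1 : (n : ℝ) - m + 1 ≠ 0) (h3 : (n : ℝ) - m + 3 ≠ 0)
    (f : X.Sec W) : φ.laplacian hφ S P f = ψ.laplacian hψ S P f := by
  obtain ⟨C, rfl⟩ := Quotient.exists_rep P
  refine (φ.laplacian_mk C S hφ h1 h3 f).trans
    (Eq.trans ?_ (ψ.laplacian_mk C S hψ h1 h3 f).symm)
  rw [φ.hessTrace_eq C S ψ hφ hψ, φ.covDiv_eq C S ψ hφ hψ]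

end Chart

/-! ### The upper connection in the bundle of volume forms -/

/-- Linearity in the second slot passes to the first by symmetry, which is available only for
homogeneous arguments. As `η` is arbitrary, it is expanded in the homogeneous `dx^j` first. -/
theorem SymTensor.mulRight_left {W : Opens M} {ε : ZMod 2} (S : SymTensor X ε) (φ : Chart X n m)
    (hφ : W ≤ φ.dom) {a q : ZMod 2} {f : X.Sec W} (hf : f ∈ X.gr W a) {ω : OneForm X W}
    (hω : ω.HasParity q) (η : OneForm X W) :
    S.app W (ω.mulRight f) η = sgn (a * (q + ε)) • (f * S.app W ω η) := by
  rw [S.app_eq_sum φ hφ, S.app_eq_sum φ hφ ω, Finset.mul_sum, Finset.smul_sum]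
  refine Finset.sum_congr rfl fun j _ => ?_
  have hj := OneForm.hasParity_d (φ.coord_mem hφ j)
  rw [← mul_assoc, ← smul_mul_assoc]
  congr 1
  rw [S.symm W _ _ _ _ (hω.mulRight hf) hj, S.mul_right, S.symm W _ _ _ _ hj hω,
    smul_mul_assoc, smul_smul, ← sgn_add,
    X.supercomm W _ _ _ (S.parity W _ _ _ _ hω hj) _ hf, smul_smul, ← sgn_add]
  refine sgn_smul_congr ?_ rfl
  generalize par j = j, a = b, q = r, ε = e
  revert j b r e; decide

namespace Chart

variable {W W' : Opens M} (C : SymConnection X) {ε : ZMod 2} (S : SymTensor X ε)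
  (φ ψ : Chart X n m) (hφ : W ≤ φ.dom) (hψ : W ≤ ψ.dom)

theorem divTensor_mem (i : Idx n m) : φ.divTensor hφ S i ∈ X.gr W (ε + par i) := by
  refine sum_mem fun j _ => smul_mem_gr _ ?_
  have := φ.pd_mem hφ j (φ.tensorCoeff_mem S hφ j i)
  rwa [show par j + (ε + par j + par i) = ε + par i by
    generalize par i = i, par j = j, ε = e
    revert i j e; decide] at this

theorem contractChristoffel_mem (i : Idx n m) :
    φ.contractChristoffel C S hφ i ∈ X.gr W (ε + par i) := by
  refine sum_mem fun j _ => sum_mem fun k _ => ?_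
  have := mul_mem_gr (φ.tensorCoeff_mem S hφ j k) (φ.christoffel_mem C hφ k j i)
  rwa [show ε + par j + par k + (par k + par j + par i) = ε + par i by
    generalize par i = i, par j = j, par k = k, ε = e
    revert i j k e; decide] at this

theorem tensorContraction_mem (i : Idx n m) :
    φ.tensorContraction C S hφ i ∈ X.gr W (ε + par i) := by
  refine sum_mem fun j _ => ?_
  have := mul_mem_gr (φ.tensorCoeff_mem S hφ i j) (φ.contraction_mem C hφ j)
  rwa [add_assoc, CharTwo.add_self_eq_zero, add_zero] at this

theorem covDiv_hasParity : Der.HasParity ε (φ.covDiv C S hφ) := by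
  refine Der.HasParity.sum fun i _ => ?_
  have := Der.HasParity.smul (add_mem (add_mem (φ.divTensor_mem S hφ i)
    (φ.contractChristoffel_mem C S hφ i)) (φ.tensorContraction_mem C S hφ i))
    (φ.pd_hasParity hφ i)
  rwa [add_assoc, CharTwo.add_self_eq_zero, add_zero] at this

/-- The function `∇^ω (s Dx) / Dx` for the upper connection with the coefficients
`r V^i - S^{ij} τ_j`, where `V` is the covariant divergence of `S`. -/
def upperOp (r : ℝ) (ω : OneForm X W) (s : X.Sec W) : X.Sec W :=
  S.app W ω (OneForm.d s) +
    (r • ω.app W le_rfl (φ.covDiv C S hφ) - S.app W ω (φ.traceForm C hφ)) * s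

variable (r : ℝ)

theorem res_upperOp (h : W' ≤ W) (ω : OneForm X W) (s : X.Sec W) :
    X.res h (φ.upperOp C S hφ r ω s) =
      φ.upperOp C S (h.trans hφ) r (ω.restrict h) (X.res h s) := by
  simp only [upperOp, map_add, map_mul, map_sub, map_smul, S.natural h, OneForm.restrict_d,
    restrict_traceForm]
  rw [ω.natural le_rfl h _ _ (φ.res_covDiv C S hφ h)]
  rfl

theorem upperOp_add_left (ω η : OneForm X W) (s : X.Sec W) :
    φ.upperOp C S hφ r (ω + η) s = φ.upperOp C S hφ r ω s + φ.upperOp C S hφ r η s := by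
  simp only [upperOp, S.add_left, OneForm.add_app, smul_add, add_mul, sub_mul]
  abel

theorem upperOp_add_right (ω : OneForm X W) (s t : X.Sec W) :
    φ.upperOp C S hφ r ω (s + t) = φ.upperOp C S hφ r ω s + φ.upperOp C S hφ r ω t := by
  simp only [upperOp, OneForm.d_add, S.add_right, mul_add]
  abel

theorem upperOp_mulRight {a q : ZMod 2} {f : X.Sec W} (hf : f ∈ X.gr W a) {ω : OneForm X W}
    (hω : ω.HasParity q) (s : X.Sec W) : φ.upperOp C S hφ r (ω.mulRight f) s =
      sgn (a * (q + ε)) • (f * φ.upperOp C S hφ r ω s) := by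
  have h := X.supercomm W _ _ _ (hω W le_rfl _ _ (φ.covDiv_hasParity C S hφ)) _ hf
  rw [upperOp, upperOp, S.mulRight_left φ hφ hf hω, S.mulRight_left φ hφ hf hω,
    OneForm.mulRight_app_self, h, add_comm ε q, mul_comm (q + ε), mul_add f, smul_add,
    ← mul_assoc f, ← smul_mul_assoc (sgn _) (f * _), mul_sub f, smul_sub, smul_comm r,
    mul_smul_comm]

theorem upperOp_mul {a q : ZMod 2} {f : X.Sec W} (hf : f ∈ X.gr W a) {ω : OneForm X W}
    (hω : ω.HasParity q) (s : X.Sec W) : φ.upperOp C S hφ r ω (f * s) =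
      S.app W ω (OneForm.d f) * s + sgn (a * (q + ε)) • (f * φ.upperOp C S hφ r ω s) := by
  have h1 : S.app W ω (OneForm.d (f * s)) = S.app W ω (OneForm.d f) * s +
      sgn (a * (q + ε)) • (f * S.app W ω (OneForm.d s)) := by
    rw [S.app_d φ hφ, S.app_d φ hφ ω f, S.app_d φ hφ ω s, Finset.sum_mul, Finset.mul_sum,
      Finset.smul_sum, ← Finset.sum_add_distrib]
    refine Finset.sum_congr rfl fun j _ => ?_
    rw [φ.pd_mul hφ j hf, mul_add, mul_assoc, mul_smul_comm, ← mul_assoc _ f,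
      X.supercomm W _ _ _ (S.parity W _ _ _ _ hω (OneForm.hasParity_d (φ.coord_mem hφ j))) _ hf,
      smul_mul_assoc, smul_smul, ← sgn_add, mul_assoc f]
    congr 1
    refine sgn_smul_congr ?_ rfl
    generalize par j = j, a = b, q = r, ε = e
    revert j b r e; decide
  have h2 := X.supercomm W _ _ _ (sub_mem
    (smul_mem_gr r (hω W le_rfl _ _ (φ.covDiv_hasParity C S hφ)))
    (show S.app W ω (φ.traceForm C hφ) ∈ X.gr W (ε + q) by
      have := S.parity W _ _ _ _ hω (φ.traceForm_hasParity C hφ)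
      rwa [add_zero] at this)) _ hf
  rw [upperOp, upperOp, h1, ← mul_assoc, h2, mul_add f, smul_add, smul_mul_assoc, mul_assoc,
    add_assoc, add_comm ε q, mul_comm (q + ε)]

theorem upperOp_mem {b q : ZMod 2} {s : X.Sec W} (hs : s ∈ X.gr W b) {ω : OneForm X W}
    (hω : ω.HasParity q) : φ.upperOp C S hφ r ω s ∈ X.gr W (ε + q + b) := by
  refine add_mem (S.parity W _ _ _ _ hω (OneForm.hasParity_d hs)) (mul_mem_gr (sub_mem
    (smul_mem_gr r (hω W le_rfl _ _ (φ.covDiv_hasParity C S hφ))) ?_) hs)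
  have := S.parity W _ _ _ _ hω (φ.traceForm_hasParity C hφ)
  rwa [add_zero] at this

/-- Differentiating the factor `Ber` in front of `s` produces `S(ω, d Ber) s`, and the change of the
trace form cancels exactly this term. The term `r ω(V)` is invariant, so `r` remains free. -/
theorem upperOp_transition (ω : OneForm X W) (s : X.Sec W) :
    φ.upperOp C S hφ r ω (berJacobian φ ψ hφ hψ * s) =
      berJacobian φ ψ hφ hψ * ψ.upperOp C S hψ r ω s := by
  have hc : ∀ g : X.Sec W, berJacobian φ ψ hφ hψ * g = g * berJacobian φ ψ hφ hψ :=
    fun g => even_comm _ g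
  have hB : berJacobian φ ψ hφ hψ ∈ X.gr W 0 := Subtype.property _
  have h1 : S.app W ω (OneForm.d (berJacobian φ ψ hφ hψ * s)) =
      S.app W ω (OneForm.d (berJacobian φ ψ hφ hψ)) * s +
        berJacobian φ ψ hφ hψ * S.app W ω (OneForm.d s) := by
    rw [S.app_d φ hφ, S.app_d φ hφ ω (berJacobian φ ψ hφ hψ), S.app_d φ hφ ω s, Finset.sum_mul,
      Finset.mul_sum, ← Finset.sum_add_distrib]
    refine Finset.sum_congr rfl fun j _ => ?_
    rw [φ.pd_mul hφ j hB, mul_zero, sgn_zero, one_smul, mul_add, mul_assoc, ← mul_assoc,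
      ← mul_assoc, ← mul_assoc, hc]
  have h2 : S.app W ω (φ.traceForm C hφ) * berJacobian φ ψ hφ hψ =
      S.app W ω (ψ.traceForm C hψ) * berJacobian φ ψ hφ hψ +
        S.app W ω (OneForm.d (berJacobian φ ψ hφ hψ)) := by
    rw [← S.mul_right, traceForm_transition C φ ψ hφ hψ, S.add_right, S.mul_right]
  rw [upperOp, upperOp, h1, φ.covDiv_eq C S ψ hφ hψ, ← mul_assoc, sub_mul, h2, mul_add,
    ← mul_assoc (berJacobian φ ψ hφ hψ), hc (_ - _), sub_mul]
  simp only [sub_mul, add_mul]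
  abel

theorem upperOp_coord (i : Idx n m) (s : X.Sec W) :
    φ.upperOp C S hφ r (OneForm.d (φ.coord hφ i)) s =
      ∑ j, φ.tensorCoeff hφ S i j * (φ.pd hφ j).1 s +
        (r • (φ.covDiv C S hφ).1 (φ.coord hφ i) - φ.tensorContraction C S hφ i) * s := by
  rw [upperOp, S.app_d φ hφ, S.app_eq_sum φ hφ _ (φ.traceForm C hφ), OneForm.d_app_self]
  simp_rw [traceForm_pd]
  rfl

end Chart

namespace VolumeForm

variable {U : Opens M}

theorem smul_comp (f : X.Sec U) (σ : VolumeForm X n m U) (φ : Chart X n m) {W : Opens M}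
    (hU : W ≤ U) (hφ : W ≤ φ.dom) : (f • σ).comp φ W hU hφ = X.res hU f * σ.comp φ W hU hφ := rfl

theorem real_smul_comp (r : ℝ) (σ : VolumeForm X n m U) (φ : Chart X n m) {W : Opens M}
    (hU : W ≤ U) (hφ : W ≤ φ.dom) : (r • σ).comp φ W hU hφ = r • σ.comp φ W hU hφ := by
  change X.res hU (algebraMap ℝ _ r) * _ = _
  rw [AlgHom.commutes, Algebra.smul_def]

theorem add_comp (σ τ : VolumeForm X n m U) (φ : Chart X n m) {W : Opens M}
    (hU : W ≤ U) (hφ : W ≤ φ.dom) :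
    (σ + τ).comp φ W hU hφ = σ.comp φ W hU hφ + τ.comp φ W hU hφ := rfl

theorem ext_comp {σ τ : VolumeForm X n m U}
    (h : ∀ φ W hU hφ, σ.comp φ W hU hφ = τ.comp φ W hU hφ) : σ = τ := by
  ext φ W hU hφ
  exact h φ W hU hφ

end VolumeForm

namespace UpperConnection

variable {ε : ZMod 2} (S : SymTensor X ε)

/-- The upper connection with the coefficients `r V^i - S^{ij} τ_j`, where `V` is the covariant
divergence of `S` and `τ_j = Γ^s_{js} (-1)^s`. -/
def ofConnection (n m : ℕ) (C : SymConnection X) (r : ℝ) : UpperConnection n m S where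
  app U ω σ :=
    -- A volume form is by definition a compatible family of components in charts, so the connection
    -- is defined chart by chart and nothing needs to be glued.
    { comp := fun φ W hU hφ => φ.upperOp C S hφ r (ω.restrict hU) (σ.comp φ W hU hφ)
      natural := fun φ W W' hU hφ h => by
        rw [φ.res_upperOp, σ.natural]
        rfl
      transition := fun φ ψ W hU hφ hψ => by
        rw [σ.transition φ ψ W hU hφ hψ, φ.upperOp_transition] }
  add_left U ω ω' σ := VolumeForm.ext_comp fun φ W hU hφ =>
    φ.upperOp_add_left C S hφ r (ω.restrict hU) (ω'.restrict hU) _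
  add_right U ω σ τ := VolumeForm.ext_comp fun φ W hU hφ => φ.upperOp_add_right C S hφ r _ _ _
  linear U a q f ω σ hf hω := VolumeForm.ext_comp fun φ W hU hφ => by
    rw [VolumeForm.real_smul_comp, VolumeForm.smul_comp]
    simp only [OneForm.restrict_mulRight]
    exact φ.upperOp_mulRight C S hφ r (X.res_mem hU a f hf) (hω.restrict hU) _
  leibniz U a q f ω σ hf hω := VolumeForm.ext_comp fun φ W hU hφ => by
    rw [VolumeForm.add_comp, VolumeForm.real_smul_comp, VolumeForm.smul_comp,
      VolumeForm.smul_comp, S.natural, OneForm.restrict_d]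
    exact φ.upperOp_mul C S hφ r (X.res_mem hU a f hf) (hω.restrict hU) _
  parity U q b ω σ hω hσ φ W hU hφ :=
    φ.upperOp_mem C S hφ r (hσ φ W hU hφ) (hω.restrict hU)
  natural h ω σ := VolumeForm.ext_comp fun φ W hU hφ => rfl

theorem ofConnection_hasCoeffs (C : SymConnection X) (r : ℝ) (φ : Chart X n m) {W : Opens M}
    (hφ : W ≤ φ.dom) : (ofConnection S n m C r).HasCoeffs φ hφ fun i =>
      r • (φ.covDiv C S hφ).1 (φ.coord hφ i) - φ.tensorContraction C S hφ i := fun i σ => by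
  change φ.upperOp C S hφ r ((OneForm.d (φ.coord hφ i)).restrict le_rfl) _ = _
  rw [OneForm.restrict_d, X.res_self, φ.upperOp_coord]

/-- An upper connection is determined by its coefficients. -/
theorem eq_of_hasCoeffs {S : SymTensor X ε} {K L : UpperConnection n m S}
    (γ : ∀ (φ : Chart X n m) (W : Opens M), W ≤ φ.dom → Idx n m → X.Sec W)
    (hK : ∀ φ W (hφ : W ≤ φ.dom), K.HasCoeffs φ hφ (γ φ W hφ))
    (hL : ∀ φ W (hφ : W ≤ φ.dom), L.HasCoeffs φ hφ (γ φ W hφ)) : K = L := by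
  ext U ω σ φ W hU hφ
  change ((K.app U ω σ).restrict hU).comp φ W le_rfl hφ =
    ((L.app U ω σ).restrict hU).comp φ W le_rfl hφ
  rw [K.natural, L.natural]
  generalize ω.restrict hU = ω, σ.restrict hU = σ
  let F : UpperConnection n m S → OneForm X W →+ X.Sec W := fun K =>
    AddMonoidHom.mk' (fun ω => (K.app W ω σ).comp φ W le_rfl hφ) fun ω ω' => by
      rw [K.add_left]; rfl
  change F K ω = F L ω
  -- The linearity axiom speaks of homogeneous multiples only; additivity in the form extends the
  -- agreement to all `f`.
  have h : ∀ (i : Idx n m) (f : X.Sec W), F K ((OneForm.d (φ.coord hφ i)).mulRight f) =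
      F L ((OneForm.d (φ.coord hφ i)).mulRight f) := fun i f => by
    induction f using sec_induction with
    | hom a f hf =>
      have hi := OneForm.hasParity_d (φ.coord_mem hφ i)
      change (K.app W _ σ).comp φ W le_rfl hφ = (L.app W _ σ).comp φ W le_rfl hφ
      rw [K.linear W a _ f _ σ hf hi, L.linear W a _ f _ σ hf hi, VolumeForm.real_smul_comp,
        VolumeForm.real_smul_comp, VolumeForm.smul_comp, VolumeForm.smul_comp,
        hK φ W hφ i σ, hL φ W hφ i σ]
    | add f g hf hg => rw [OneForm.mulRight_add, map_add, map_add, hf, hg]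
  rw [φ.oneForm_eq_sum hφ ω, map_sum, map_sum]
  exact Finset.sum_congr rfl fun i _ => h i _

end UpperConnection

end

end Supergeometry

/-! ### The projective Laplacian and the upper connection of a projective class -/

theorem mainTheorem1 {M : Type*} [TopologicalSpace M] (X : Supergeometry.SuperSpace M) (n m : ℕ)
    (hX : Supergeometry.IsSupermanifold X n m)
    (h1 : (n : ℤ) - m ≠ -1) (h3 : (n : ℤ) - m ≠ -3)
    (P : Supergeometry.ProjectiveClass X n m) (ε : ZMod 2) (S : Supergeometry.SymTensor X ε) :
    ((∀ (φ ψ : Supergeometry.Chart X n m) (W : TopologicalSpace.Opens M)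
        (hφ : W ≤ φ.dom) (hψ : W ≤ ψ.dom) (f : X.Sec W),
        φ.laplacian hφ S P f = ψ.laplacian hψ S P f) ∧
      ∃! Δ : Supergeometry.Operator X,
        ∀ (φ : Supergeometry.Chart X n m) (W : TopologicalSpace.Opens M) (hW : W ≤ φ.dom)
          (f : X.Sec W), Δ.app W f = φ.laplacian hW S P f) ∧
    ∃! K : Supergeometry.UpperConnection n m S,
      ∀ (φ : Supergeometry.Chart X n m) (W : TopologicalSpace.Opens M) (hW : W ≤ φ.dom),
        K.HasCoeffs φ hW (φ.upperCoeff hW S P) := by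
  have h1' : (n : ℝ) - m + 1 ≠ 0 := by simpa using Supergeometry.real_ne_zero_of_int (k := 1) h1
  have h3' : (n : ℝ) - m + 3 ≠ 0 := by simpa using Supergeometry.real_ne_zero_of_int (k := 3) h3
  have hlap : ∀ (φ ψ : Supergeometry.Chart X n m) (W : TopologicalSpace.Opens M)
      (hφ : W ≤ φ.dom) (hψ : W ≤ ψ.dom) (f : X.Sec W),
      φ.laplacian hφ S P f = ψ.laplacian hψ S P f := fun φ ψ W hφ hψ f =>
    φ.laplacian_eq ψ S P hφ hψ h1' h3' f
  refine ⟨⟨hlap, hX.existsUnique_operator (fun φ W hφ => φ.laplacianLin S P hφ)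
    (fun φ W W' hφ h f => φ.res_laplacian S P hφ h1' h3' h f) hlap⟩, ?_⟩
  -- The existence proof uses a representative connection, but the coefficients depend only on its
  -- class; the value `r = (n-m+1)/(n-m+3)` below is the one found in `upperCoeff_mk`.
  obtain ⟨C, rfl⟩ : ∃ C : Supergeometry.SymConnection X, C.projClass n m = P :=
    Quotient.exists_rep P
  have hK : ∀ (φ : Supergeometry.Chart X n m) (W : TopologicalSpace.Opens M) (hW : W ≤ φ.dom),
      (Supergeometry.UpperConnection.ofConnection S n m C
        (((n : ℝ) - m + 1) / ((n : ℝ) - m + 3))).HasCoeffs φ hW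
        (φ.upperCoeff hW S (C.projClass n m)) := fun φ W hW => by
    have := Supergeometry.UpperConnection.ofConnection_hasCoeffs S C
      (((n : ℝ) - m + 1) / ((n : ℝ) - m + 3)) φ hW
    simpa only [← φ.upperCoeff_mk C S hW h1' h3'] using this
  exact ⟨_, hK, fun L hL => Supergeometry.UpperConnection.eq_of_hasCoeffs
    (fun φ W hW => φ.upperCoeff hW S (C.projClass n m)) hL hK⟩
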